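/- Let $R$ be a commutative ring. A graded quiver $Q$ is a set of objects with a $\mathbb Z$-graded $R$-module $Q(x,y)$ for all objects $x,y$. A formal morphism $F:Q\to Q'$ consists of a map $F^0$ on objects and, for $n\ge 1$, graded $R$-linear maps $F^n:Q(x_{n-1},x_n)\otimes\dots\otimes Q(x_0,x_1)\to Q'(F^0x_0,F^0x_n)[1-n]$; formal morphisms compose by $(G\cdot F)^n(q_n,\dots,q_1)=\sum_{i_r+\dots+i_1=n}G^r(F^{i_r}(q_n,\dots),\dots,F^{i_1}(q_{i_1},\dots,q_1))$ (with all $i_j\ge1$). An $A_\infty$-structure on $Q$ (neither units nor flatness are assumed) is a family of operations $m^n$, $n\ge 0$, of degree $2-n$, with $\sum_{d,k\ge0,\ d+k\le n}(-1)^{\dagger_d}m^{n-k+1}(f_n,\dots,f_{d+k+1},m^k(f_{d+k},\dots,f_{d+1}),f_d,\dots,f_1)=0$ for all $n\ge 0$, where $\dagger_d=\deg f_1+\dots+\deg f_d-d$. A formal morphism $F:(Q,m)\to(Q',m')$ is an $A_\infty$-functor if $\sum_{d,k}(-1)^{\dagger_d}F^{n-k+1}(f_n,\dots,m^k(f_{d+k},\dots,f_{d+1}),f_d,\dots,f_1)=\sum_{i_r+\dots+i_1=n}m'^r(F^{i_r}(f_n,\dots),\dots,F^{i_1}(f_{i_1},\dots,f_1))$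 for all $n\ge0$. Let $\mathscr A,\mathscr A',\mathscr A''$ be $A_\infty$-categories (graded quivers with $A_\infty$-structures), let $\mathscr G:\mathscr A''\to\mathscr A'$ be an $A_\infty$-functor, and let $\mathscr F:\mathscr A\to\mathscr A'$ be an $A_\infty$-functor such that every $\mathscr F^1:\mathscr A(x,y)\to\mathscr A'(\mathscr F^0x,\mathscr F^0y)$ is a graded-split surjection. Fix degree $0$ sections $s^1$ of the $\mathscr F^1$, put $K(x,y)=\ker(\mathscr F^1:\mathscr A(x,y)\to\mathscr A'(\mathscr F^0x,\mathscr F^0y))$, and let $r^1=\mathrm{id}-s^1\mathscr F^1:\mathscr A(x,y)\to K(x,y)$. Consider the following graded quivers. - $(K\times\mathscr A')_S$ has as objects the pairs $(a,\mathscr F^0(a))$, with $a$ an object of $\mathscr A$, and as graded modules of arrows $K(a_1,a_2)\oplus\mathscr A'(\mathscr F^0a_1,\mathscr F^0a_2)$. - $(K\times\mathscr A'')_{S'}$ has as objects the pairs $(x,y)$ of an object $x$ of $\mathscr A$ and an object $y$ of $\mathscr A''$ with $\mathscr F^0(x)=\mathscr G^0(y)$, and as graded modules of arrows $K(x_1,x_2)\oplus\mathscr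 A''(y_1,y_2)$. Let $\Phi:\mathscr A\to\mathscr A$ be the formal automorphism with $\Phi^0=\mathrm{Id}$, $\Phi^1=\mathrm{Id}$ and $\Phi^n=s^1\mathscr F^n$ for $n\ge2$. There is a unique $A_\infty$-structure $m_{(K\times\mathscr A')_S}$ on $(K\times\mathscr A')_S$ for which the composition of $\Phi$ with the isomorphism of graded quivers $\mathscr A\cong(K\times\mathscr A')_S$, $a\mapsto(a,\mathscr F^0a)$, $f\mapsto(r^1f,\mathscr F^1f)$, is an $A_\infty$-functor, and for this structure the projection $\mathrm{pr}_{\mathscr A'}:(K\times\mathscr A')_S\to\mathscr A'$ (the strict formal morphism $(k,a')\mapsto a'$) is an $A_\infty$-functor. Moreover, the graded quiver $(K\times\mathscr A'')_{S'}$ has an $A_\infty$-structure for which both the projection $\mathrm{pr}_{\mathscr A''}:(K\times\mathscr A'')_{S'}\to\mathscr A''$ (the strict formal morphism $(k,a'')\mapsto a''$) and the formal morphism $\mathrm{Id}_K\times\mathscr G:(K\times\mathscr A'')_{S'}\to(K\times\mathscr A')_S$, given by $(x,y)\mapsto(x,\mathscr G^0y)$ on objects, $(k_1,a_1'')\mapsto(k_1,\mathscr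 G^1(a_1''))$ for $n=1$ and $((k_n,a_n''),\dots,(k_1,a_1''))\mapsto(0,\mathscr G^n(a_n'',\dots,a_1''))$ for $n\ge2$, are $A_\infty$-functors (the target of the latter with the structure $m_{(K\times\mathscr A')_S}$), and $\mathscr G\cdot\mathrm{pr}_{\mathscr A''}=\mathrm{pr}_{\mathscr A'}\cdot(\mathrm{Id}_K\times\mathscr G)$. In other words, the square formed by these four morphisms is a commutative square of $A_\infty$-categories and $A_\infty$-functors. -/

import Mathlib

open scoped DirectSum

namespace AInfinity

set_option linter.checkUnivs false

universe w u v u' v' u'' v'' u₃ v₃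

/-! ### Graded quivers -/

/-- A graded quiver over `R`: a type of objects and, for every pair of objects, a `ℤ`-graded
`R`-module, given as an `R`-module which is the internal direct sum of its degree `d` parts
`gr x y d`. -/
structure GQuiver (R : Type w) [CommRing R] where
  Ob : Type u
  Hom : Ob → Ob → Type v
  [addCommGroup : ∀ x y, AddCommGroup (Hom x y)]
  [module : ∀ x y, Module R (Hom x y)]
  gr : ∀ x y, ℤ → Submodule R (Hom x y)
  isInternal : ∀ x y, DirectSum.IsInternal (gr x y)

attribute [instance] GQuiver.addCommGroup GQuiver.module

section

variable {R : Type w} [CommRing R]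

/-- The `R`-linear involution `f ↦ (-1)^(deg f - 1) f`. It records the Koszul sign produced when an
operator of odd (shifted) degree moves past `f`. -/
noncomputable def GQuiver.sgn (Q : GQuiver.{w, u, v} R) (x y : Q.Ob) :
    Q.Hom x y →ₗ[R] Q.Hom x y :=
  (DirectSum.toModule R ℤ (Q.Hom x y)
      (fun d => ((d - 1).negOnePow : ℤ) • (Q.gr x y d).subtype)).comp
    (LinearEquiv.ofBijective (DirectSum.coeLinearMap (Q.gr x y))
      (Q.isInternal x y)).symm.toLinearMap

theorem GQuiver.sgn_of_mem (Q : GQuiver.{w, u, v} R) {x y : Q.Ob} {d : ℤ} {f : Q.Hom x y}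
    (hf : f ∈ Q.gr x y d) : Q.sgn x y f = ((d - 1).negOnePow : ℤ) • f := by
  have h : (LinearEquiv.ofBijective (DirectSum.coeLinearMap (Q.gr x y))
      (Q.isInternal x y)).symm f = DirectSum.lof R ℤ (fun d => Q.gr x y d) d ⟨f, hf⟩ := by
    rw [LinearEquiv.symm_apply_eq]
    exact (DirectSum.coeLinearMap_lof (A := Q.gr x y) d ⟨f, hf⟩).symm
  simp only [GQuiver.sgn, LinearMap.comp_apply, LinearEquiv.coe_coe, h]
  simp

/-! ### Chains of composable arrows -/

/-- Finite chains of composable arrows `x = x₀ → x₁ → ⋯ → xₙ = y` of a graded quiver; `nil` is the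
chain of length `n = 0`. The arrow `f₁ : x₀ → x₁` comes first. -/
inductive Chain (Q : GQuiver.{w, u, v} R) : Q.Ob → Q.Ob → Type (max u v)
  | nil {x : Q.Ob} : Chain Q x x
  | cons {x y z : Q.Ob} (f : Q.Hom x y) (c : Chain Q y z) : Chain Q x z

namespace Chain

variable {Q : GQuiver.{w, u, v} R}

/-- The number of arrows. -/
def length : ∀ {x y : Q.Ob}, Chain Q x y → ℕ
  | _, _, nil => 0
  | _, _, cons _ c => c.length + 1

/-- Concatenation. -/
def append : ∀ {x y z : Q.Ob}, Chain Q x y → Chain Q y z → Chain Q x z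
  | _, _, _, nil, q => q
  | _, _, _, cons f p, q => cons f (append p q)

/-- The image of a chain under a map of objects and maps on arrows. -/
def map {Q' : GQuiver.{w, u', v'} R} (o : Q.Ob → Q'.Ob)
    (φ : ∀ x y : Q.Ob, Q.Hom x y → Q'.Hom (o x) (o y)) :
    ∀ {x y : Q.Ob}, Chain Q x y → Chain Q' (o x) (o y)
  | _, _, nil => nil
  | _, _, cons f c => cons (φ _ _ f) (map o φ c)

/-- Apply the sign involution to every arrow: on a chain of homogeneous arrows `f₁, …, f_d` this is
the chain `f₁, …, f_d` up to the sign `(-1)^(deg f₁ + ⋯ + deg f_d - d)`. -/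
noncomputable def signed {x y : Q.Ob} (c : Chain Q x y) : Chain Q x y :=
  c.map (fun x => x) (fun x y f => Q.sgn x y f)

/-- `c.IsHomogeneous e`: the arrows of `c` are homogeneous, with degrees that add up to `e`. -/
inductive IsHomogeneous : ∀ {x y : Q.Ob}, Chain Q x y → ℤ → Prop
  | nil {x : Q.Ob} : IsHomogeneous (nil : Chain Q x x) 0
  | cons {x y z : Q.Ob} {f : Q.Hom x y} {c : Chain Q y z} {d e : ℤ} (hf : f ∈ Q.gr x y d)
      (hc : IsHomogeneous c e) : IsHomogeneous (cons f c) (d + e)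

/-- A function on the chains from `x` to `y` is multilinear if it is `R`-linear in each arrow, i.e.
if for all `n` and all `x = x₀, …, xₙ = y` it is induced by an `R`-linear map on
`Q(x₀,x₁) ⊗ ⋯ ⊗ Q(xₙ₋₁,xₙ)`. -/
def IsMultilinear {M : Type*} [AddCommGroup M] [Module R M] {x y : Q.Ob}
    (φ : Chain Q x y → M) : Prop :=
  ∀ (a b : Q.Ob) (p : Chain Q x a) (q : Chain Q b y) (r : R) (f g : Q.Hom a b),
    φ (p.append (cons (r • f + g) q)) =
      r • φ (p.append (cons f q)) + φ (p.append (cons g q))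

/-- A way of cutting a chain in two. -/
structure Cut (Q : GQuiver.{w, u, v} R) (x z : Q.Ob) where
  mid : Q.Ob
  left : Chain Q x mid
  right : Chain Q mid z

/-- All the `n + 1` ways of cutting a chain of length `n` in two (possibly empty) chains. -/
def cuts : ∀ {x z : Q.Ob}, Chain Q x z → List (Cut Q x z)
  | _, _, nil => [⟨_, nil, nil⟩]
  | _, _, cons f c => ⟨_, nil, cons f c⟩ :: (cuts c).map fun s => ⟨s.mid, cons f s.left, s.right⟩

/-- The terms of the value at the chain `(f₁, …, fₙ)` of the coderivation of the bar construction
induced by the operations `m`: the list of all the chains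
`(-1)^(deg f₁ + ⋯ + deg f_d - d) (f₁, …, f_d, m(f_{d+1}, …, f_{d+k}), f_{d+k+1}, …, fₙ)`
with `0 ≤ d`, `0 ≤ k` and `d + k ≤ n`. -/
noncomputable def barD (m : ∀ {x y : Q.Ob}, Chain Q x y → Q.Hom x y) {x z : Q.Ob}
    (c : Chain Q x z) : List (Chain Q x z) :=
  c.cuts.flatMap fun s => s.right.cuts.map fun t =>
    s.left.signed.append (cons (m t.left) t.right)

/-- Auxiliary to `barF`: the chains obtained from `(p, c)` when the first block contains `p`. -/
def barFAux {Q' : GQuiver.{w, u', v'} R} (o : Q.Ob → Q'.Ob)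
    (F : ∀ {x y : Q.Ob}, Chain Q x y → Q'.Hom (o x) (o y)) :
    ∀ {x y z : Q.Ob}, Chain Q x y → Chain Q y z → List (Chain Q' (o x) (o z))
  | _, _, _, p, nil => [cons (F p) nil]
  | _, _, _, p, cons f c =>
      barFAux o F (p.append (cons f nil)) c ++ (barFAux o F (cons f nil) c).map (cons (F p))

/-- The terms of the value at the chain `(f₁, …, fₙ)` of the map of bar constructions induced by
`F`: the list, over all `i₁ + ⋯ + i_r = n` with `i_j ≥ 1`, of the chains
`(F(f₁, …, f_{i₁}), F(f_{i₁+1}, …, f_{i₁+i₂}), …)`. -/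
def barF {Q' : GQuiver.{w, u', v'} R} (o : Q.Ob → Q'.Ob)
    (F : ∀ {x y : Q.Ob}, Chain Q x y → Q'.Hom (o x) (o y)) :
    ∀ {x z : Q.Ob}, Chain Q x z → List (Chain Q' (o x) (o z))
  | _, _, nil => [nil]
  | _, _, cons f c => barFAux o F (cons f nil) c

theorem append_assoc : ∀ {x y z t : Q.Ob} (p : Chain Q x y) (q : Chain Q y z) (r : Chain Q z t),
    (p.append q).append r = p.append (q.append r)
  | _, _, _, _, nil, _, _ => rfl
  | _, _, _, _, cons f p, q, r => congrArg (cons f) (append_assoc p q r)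

theorem length_append : ∀ {x y z : Q.Ob} (p : Chain Q x y) (q : Chain Q y z),
    (p.append q).length = p.length + q.length
  | _, _, _, nil, q => by simp [append, length]
  | _, _, _, cons f p, q => by simp only [append, length, length_append p q]; omega

theorem IsHomogeneous.append {x y z : Q.Ob} {p : Chain Q x y} {q : Chain Q y z} {d e : ℤ}
    (hp : p.IsHomogeneous d) (hq : q.IsHomogeneous e) : (p.append q).IsHomogeneous (d + e) := by
  induction hp with
  | nil => simpa [Chain.append] using hq
  | cons hf hc ih => rw [add_assoc]; exact .cons hf (ih hq)

theorem IsMultilinear.cons {M : Type*} [AddCommGroup M] [Module R M] {x y z : Q.Ob}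
    {φ : Chain Q x z → M} (h : IsMultilinear φ) (f : Q.Hom x y) :
    IsMultilinear fun t => φ (cons f t) :=
  fun a b p q r f' g' => h a b (Chain.cons f p) q r f' g'

theorem map_append {Q' : GQuiver.{w, u', v'} R} (o : Q.Ob → Q'.Ob)
    (φ : ∀ x y : Q.Ob, Q.Hom x y → Q'.Hom (o x) (o y)) :
    ∀ {x y z : Q.Ob} (p : Chain Q x y) (q : Chain Q y z),
      (p.append q).map o φ = (p.map o φ).append (q.map o φ)
  | _, _, _, nil, _ => rfl
  | _, _, _, cons _ p, q => congrArg (cons _) (map_append o φ p q)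

theorem length_map {Q' : GQuiver.{w, u', v'} R} (o : Q.Ob → Q'.Ob)
    (φ : ∀ x y : Q.Ob, Q.Hom x y → Q'.Hom (o x) (o y)) :
    ∀ {x y : Q.Ob} (p : Chain Q x y), (p.map o φ).length = p.length
  | _, _, nil => rfl
  | _, _, cons _ p => congrArg (· + 1) (length_map o φ p)

theorem IsHomogeneous.map {Q' : GQuiver.{w, u', v'} R} (o : Q.Ob → Q'.Ob)
    (φ : ∀ x y : Q.Ob, Q.Hom x y → Q'.Hom (o x) (o y))
    (hφ : ∀ x y d f, f ∈ Q.gr x y d → φ x y f ∈ Q'.gr (o x) (o y) d)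
    {x y : Q.Ob} {p : Chain Q x y} {d : ℤ} (hp : p.IsHomogeneous d) :
    (p.map o φ).IsHomogeneous d := by
  induction hp with
  | nil => exact .nil
  | cons hf hc ih => exact .cons (hφ _ _ _ _ hf) ih

end Chain

/-! ### Formal morphisms -/

/-- A formal morphism of graded quivers: a map on objects (the component `n = 0`) and, for `n ≥ 1`,
graded multilinear maps of degree `1 - n` on chains of length `n`. The value of `map` on chains of
length zero carries no information and is set to be `0`. -/
@[ext]
structure FormalMorphism (Q : GQuiver.{w, u, v} R) (Q' : GQuiver.{w, u', v'} R) where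
  obj : Q.Ob → Q'.Ob
  map : ∀ {x y : Q.Ob}, Chain Q x y → Q'.Hom (obj x) (obj y)
  map_nil : ∀ x : Q.Ob, map (Chain.nil : Chain Q x x) = 0
  multilinear : ∀ x y : Q.Ob, Chain.IsMultilinear (fun c : Chain Q x y => map c)
  map_mem : ∀ {x y : Q.Ob} (c : Chain Q x y) (e : ℤ), c.IsHomogeneous e →
    map c ∈ Q'.gr (obj x) (obj y) (e + 1 - c.length)

namespace FormalMorphism

variable {Q : GQuiver.{w, u, v} R} {Q' : GQuiver.{w, u', v'} R} {Q'' : GQuiver.{w, u'', v''} R}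

section comp

variable {M : Type*} [AddCommGroup M] [Module R M]

theorem sum_barFAux_left (F : FormalMorphism Q Q') {y z : Q.Ob} (c : Chain Q y z) :
    ∀ {x a b : Q.Ob} (φ : Chain Q' (F.obj x) (F.obj z) → M), Chain.IsMultilinear φ →
      ∀ (p : Chain Q x a) (q : Chain Q b y) (r : R) (f g : Q.Hom a b),
    ((Chain.barFAux F.obj F.map (p.append (.cons (r • f + g) q)) c).map φ).sum =
      r • ((Chain.barFAux F.obj F.map (p.append (.cons f q)) c).map φ).sum +
      ((Chain.barFAux F.obj F.map (p.append (.cons g q)) c).map φ).sum := by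
  induction c with
  | nil =>
    intro x a b φ hφ p q r f g
    have h1 := F.multilinear _ _ a b p q r f g
    have h2 := hφ _ _ .nil .nil r (F.map (p.append (.cons f q))) (F.map (p.append (.cons g q)))
    simp only [Chain.append] at h1 h2
    simp [Chain.barFAux, h1, h2]
  | cons h c ih =>
    intro x a b φ hφ p q r f g
    have h1 := F.multilinear _ _ a b p q r f g
    have h2 := fun t => hφ _ _ .nil t r
      (F.map (p.append (.cons f q))) (F.map (p.append (.cons g q)))
    simp only [Chain.append] at h1 h2
    have h3 := ih φ hφ p (q.append (.cons h .nil)) r f g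
    simp only [Chain.barFAux, List.map_append, List.map_map, List.sum_append, Chain.append_assoc,
      Chain.append, h3, h1]
    have h4 : ∀ l : List (Chain Q' _ (F.obj _)),
        (l.map (φ ∘ Chain.cons (r • F.map (p.append (.cons f q)) +
          F.map (p.append (.cons g q))))).sum =
        r • (l.map (φ ∘ Chain.cons (F.map (p.append (.cons f q))))).sum +
        (l.map (φ ∘ Chain.cons (F.map (p.append (.cons g q))))).sum := by
      intro l
      induction l with
      | nil => simp
      | cons t l ihl =>
        simp only [List.map_cons, List.sum_cons, ihl, Function.comp, h2, smul_add]
        abel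
    rw [h4, smul_add]
    abel

theorem sum_barFAux_right (F : FormalMorphism Q Q') {y a b : Q.Ob} (p : Chain Q y a) :
    ∀ {x z : Q.Ob} (φ : Chain Q' (F.obj x) (F.obj z) → M), Chain.IsMultilinear φ →
      ∀ (t : Chain Q x y) (q : Chain Q b z) (r : R) (f g : Q.Hom a b),
    ((Chain.barFAux F.obj F.map t (p.append (.cons (r • f + g) q))).map φ).sum =
      r • ((Chain.barFAux F.obj F.map t (p.append (.cons f q))).map φ).sum +
      ((Chain.barFAux F.obj F.map t (p.append (.cons g q))).map φ).sum := by
  induction p with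
  | nil =>
    intro x z φ hφ t q r f g
    have h1 := F.sum_barFAux_left q φ hφ t .nil r f g
    have h2 := F.sum_barFAux_left q (fun s => φ (.cons (F.map t) s)) (hφ.cons _) .nil .nil r f g
    simp only [Chain.append] at h2
    simp only [Chain.append, Chain.barFAux, List.map_append, List.map_map, List.sum_append, h1,
      Function.comp_def, h2, smul_add]
    abel
  | cons h p ih =>
    intro x z φ hφ t q r f g
    have h1 := ih φ hφ (t.append (.cons h .nil)) q r f g
    have h2 := ih (fun s => φ (.cons (F.map t) s)) (hφ.cons _) (.cons h .nil) q r f g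
    simp only [Chain.append, Chain.barFAux, List.map_append, List.map_map, List.sum_append, h1,
      Function.comp_def, h2, smul_add]
    abel

theorem sum_barF_multilinear (F : FormalMorphism Q Q') {x z : Q.Ob}
    (φ : Chain Q' (F.obj x) (F.obj z) → M) (hφ : Chain.IsMultilinear φ) :
    Chain.IsMultilinear fun c : Chain Q x z => ((Chain.barF F.obj F.map c).map φ).sum := by
  intro a b p q r f g
  cases p with
  | nil => exact F.sum_barFAux_left q φ hφ .nil .nil r f g
  | cons h p => exact F.sum_barFAux_right p φ hφ (.cons h .nil) q r f g

end comp

theorem barFAux_homogeneous (F : FormalMorphism Q Q') {y z : Q.Ob} {c : Chain Q y z} {e : ℤ}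
    (hc : c.IsHomogeneous e) : ∀ {x : Q.Ob} (p : Chain Q x y) (d : ℤ), p.IsHomogeneous d →
      ∀ t ∈ Chain.barFAux F.obj F.map p c,
        t.IsHomogeneous (d + e - p.length - c.length + t.length) := by
  induction hc with
  | nil =>
    intro x p d hp t ht
    simp only [Chain.barFAux, List.mem_singleton] at ht
    subst ht
    have := Chain.IsHomogeneous.cons (F.map_mem p d hp) .nil
    convert this using 1
    simp [Chain.length]
    ring
  | @cons x' y' z' f c d' e' hf hc ih =>
    intro x p d hp t ht
    simp only [Chain.barFAux, List.mem_append, List.mem_map] at ht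
    rcases ht with ht | ⟨t, ht, rfl⟩
    · have := ih _ _ (hp.append (.cons hf .nil)) t ht
      convert this using 1
      simp [Chain.length, Chain.length_append]
      ring
    · have := Chain.IsHomogeneous.cons (F.map_mem p d hp) (ih _ _ (.cons hf .nil) t ht)
      convert this using 1
      simp [Chain.length]
      ring

theorem barF_homogeneous (F : FormalMorphism Q Q') {x z : Q.Ob} {c : Chain Q x z} {e : ℤ}
    (hc : c.IsHomogeneous e) (t : Chain Q' (F.obj x) (F.obj z))
    (ht : t ∈ Chain.barF F.obj F.map c) : t.IsHomogeneous (e - c.length + t.length) := by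
  cases hc with
  | nil =>
    simp only [Chain.barF, List.mem_singleton] at ht
    subst ht
    simpa [Chain.length] using Chain.IsHomogeneous.nil
  | cons hf hc =>
    have := F.barFAux_homogeneous hc _ _ (.cons hf .nil) t ht
    convert this using 1
    simp [Chain.length]
    ring

/-- Composition of formal morphisms:
`(G · F)(f₁, …, fₙ) = ∑ G(F(f₁, …, f_{i₁}), …, F(f_{n-i_r+1}, …, fₙ))`, the sum being over all
`i₁ + ⋯ + i_r = n`. -/
def comp (G : FormalMorphism Q' Q'') (F : FormalMorphism Q Q') : FormalMorphism Q Q'' where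
  obj x := G.obj (F.obj x)
  map c := ((Chain.barF F.obj F.map c).map fun t => G.map t).sum
  map_nil x := by simp [Chain.barF, G.map_nil]
  multilinear x y := F.sum_barF_multilinear _ (G.multilinear _ _)
  map_mem {x y} c e hc := by
    apply list_sum_mem
    intro g hg
    obtain ⟨t, ht, rfl⟩ := List.mem_map.1 hg
    have := G.map_mem t _ (F.barF_homogeneous hc t ht)
    convert this using 2
    ring

/-- The linear component `F¹ : Q(x, y) → Q'(F⁰ x, F⁰ y)`. -/
def lin (F : FormalMorphism Q Q') (x y : Q.Ob) : Q.Hom x y →ₗ[R] Q'.Hom (F.obj x) (F.obj y) :=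
  have key : ∀ (r : R) (f g : Q.Hom x y), F.map (.cons (r • f + g) .nil) =
      r • F.map (.cons f .nil) + F.map (.cons g .nil) := fun r f g =>
    F.multilinear x y x y .nil .nil r f g
  have hz : F.map (.cons (0 : Q.Hom x y) .nil) = 0 := by simpa using key 1 0 0
  { toFun f := F.map (.cons f .nil)
    map_add' f g := by simpa using key 1 f g
    map_smul' r f := by simpa [hz] using key r f 0 }

theorem lin_apply (F : FormalMorphism Q Q') (x y : Q.Ob) (f : Q.Hom x y) :
    F.lin x y f = F.map (.cons f .nil) := rfl

theorem lin_mem (F : FormalMorphism Q Q') {x y : Q.Ob} {d : ℤ} {f : Q.Hom x y}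
    (hf : f ∈ Q.gr x y d) : F.lin x y f ∈ Q'.gr (F.obj x) (F.obj y) d := by
  have := F.map_mem _ _ (.cons hf .nil)
  simpa [Chain.length, lin_apply] using this

/-- The family of maps which is `φ` on chains of length one and zero on all other chains. -/
def linMap (o : Q.Ob → Q'.Ob) (φ : ∀ x y : Q.Ob, Q.Hom x y →ₗ[R] Q'.Hom (o x) (o y)) :
    ∀ {x y : Q.Ob}, Chain Q x y → Q'.Hom (o x) (o y)
  | _, _, .nil => 0
  | _, _, .cons f .nil => φ _ _ f
  | _, _, .cons _ (.cons _ _) => 0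

theorem linMap_multilinear (o : Q.Ob → Q'.Ob)
    (φ : ∀ x y : Q.Ob, Q.Hom x y →ₗ[R] Q'.Hom (o x) (o y)) (x y : Q.Ob) :
    Chain.IsMultilinear fun c : Chain Q x y => linMap o φ c := by
  intro a b p q r f g
  cases p with
  | nil => cases q <;> simp [Chain.append, linMap]
  | cons h p => cases p <;> simp [Chain.append, linMap]

theorem linMap_mem (o : Q.Ob → Q'.Ob) (φ : ∀ x y : Q.Ob, Q.Hom x y →ₗ[R] Q'.Hom (o x) (o y))
    (hφ : ∀ x y d f, f ∈ Q.gr x y d → φ x y f ∈ Q'.gr (o x) (o y) d)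
    {x y : Q.Ob} (c : Chain Q x y) (e : ℤ) (hc : c.IsHomogeneous e) :
    linMap o φ c ∈ Q'.gr (o x) (o y) (e + 1 - c.length) := by
  cases hc with
  | nil => simp [linMap]
  | cons hf hc =>
    cases hc with
    | nil => simpa [linMap, Chain.length] using hφ _ _ _ _ hf
    | cons hg hc => simp [linMap]

/-- A functor of graded quivers (the strict case), seen as a formal morphism with zero components
for `n ≥ 2`. -/
def ofLinear (o : Q.Ob → Q'.Ob) (φ : ∀ x y : Q.Ob, Q.Hom x y →ₗ[R] Q'.Hom (o x) (o y))
    (hφ : ∀ x y d f, f ∈ Q.gr x y d → φ x y f ∈ Q'.gr (o x) (o y) d) :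
    FormalMorphism Q Q' where
  obj := o
  map c := linMap o φ c
  map_nil _ := rfl
  multilinear x y := linMap_multilinear o φ x y
  map_mem c e hc := linMap_mem o φ hφ c e hc

end FormalMorphism

/-! ### A∞-structures and A∞-functors -/

/-- An A∞-structure on a graded quiver `Q` (not assumed to be unital or flat): graded multilinear
operations `mⁿ` of degree `2 - n` on the chains of length `n ≥ 0`, with
`∑ (-1)^(deg f₁ + ⋯ + deg f_d - d) m(f₁, …, f_d, m(f_{d+1}, …, f_{d+k}), f_{d+k+1}, …, fₙ) = 0`
for all chains `(f₁, …, fₙ)`, `n ≥ 0`, the sum being over all `d, k ≥ 0` with `d + k ≤ n`. -/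
@[ext]
structure AInfStructure (Q : GQuiver.{w, u, v} R) where
  m : ∀ {x y : Q.Ob}, Chain Q x y → Q.Hom x y
  multilinear : ∀ x y : Q.Ob, Chain.IsMultilinear (fun c : Chain Q x y => m c)
  m_mem : ∀ {x y : Q.Ob} (c : Chain Q x y) (e : ℤ), c.IsHomogeneous e →
    m c ∈ Q.gr x y (e + 2 - c.length)
  stasheff : ∀ {x y : Q.Ob} (c : Chain Q x y), ((Chain.barD m c).map fun t => m t).sum = 0

/-- A formal morphism `F` is an A∞-functor `(Q, D) → (Q', D')` if `𝓛_F(D) = 𝓡_F(D')`, that is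
`∑ (-1)^(deg f₁ + ⋯ + deg f_d - d) F(f₁, …, f_d, D(f_{d+1}, …, f_{d+k}), f_{d+k+1}, …, fₙ)
  = ∑ D'(F(f₁, …, f_{i₁}), …, F(f_{n-i_r+1}, …, fₙ))` for all chains, `n ≥ 0`. -/
def IsAInfFunctor {Q : GQuiver.{w, u, v} R} {Q' : GQuiver.{w, u', v'} R} (D : AInfStructure Q)
    (D' : AInfStructure Q') (F : FormalMorphism Q Q') : Prop :=
  ∀ {x y : Q.Ob} (c : Chain Q x y),
    ((Chain.barD D.m c).map fun t => F.map t).sum =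
      ((Chain.barF F.obj F.map c).map fun t => D'.m t).sum

/-! ### Graded modules: products and kernels -/

/-- A family of submodules is an internal grading iff it comes with projections. -/
theorem isInternal_iff_proj {M : Type*} [AddCommGroup M] [Module R M] (A : ℤ → Submodule R M) :
    DirectSum.IsInternal A ↔ ∃ P : ℤ → M →ₗ[R] M, (∀ d m, P d m ∈ A d) ∧
      (∀ d, ∀ m ∈ A d, P d m = m) ∧ (∀ d e, d ≠ e → ∀ m ∈ A e, P d m = 0) ∧
      ∀ m, ∃ s : Finset ℤ, ∀ t, s ⊆ t → ∑ d ∈ t, P d m = m := by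
  constructor
  · intro hA
    let _ := hA.chooseDecomposition
    refine ⟨fun d => (A d).subtype ∘ₗ DirectSum.component R ℤ (fun d => A d) d ∘ₗ
      (DirectSum.decomposeLinearEquiv A).toLinearMap, fun d m => Submodule.coe_mem _,
      fun d m hm => DirectSum.decompose_of_mem_same A hm,
      fun d e hde m hm => DirectSum.decompose_of_mem_ne A hm hde.symm, fun m => ?_⟩
    classical
    refine ⟨(DirectSum.decompose A m).support, fun t ht => ?_⟩
    rw [← Finset.sum_subset ht]
    · exact DirectSum.sum_support_decompose A m
    · intro d _ hd
      have : DirectSum.decompose A m d = 0 := by simpa using hd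
      exact congrArg Subtype.val this
  · rintro ⟨P, h1, h2, h3, h4⟩
    constructor
    · have key : ∀ (x : DirectSum ℤ fun d => A d) (d : ℤ),
          P d (DirectSum.coeAddMonoidHom A x) = x d := by
        intro x d
        induction x using DirectSum.induction_on with
        | zero => simp
        | of e m =>
          rw [DirectSum.coeAddMonoidHom_of]
          by_cases h : d = e
          · subst h; simp [h2 d m m.2]
          · simp [h3 d e h m m.2, DirectSum.of_eq_of_ne _ _ _ h]
        | add x y hx hy => simp [hx, hy]
      intro x y hxy
      ext d
      rw [← key, ← key, hxy]
    · intro m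
      obtain ⟨s, hs⟩ := h4 m
      refine ⟨∑ d ∈ s, DirectSum.of (fun d => A d) d ⟨P d m, h1 d m⟩, ?_⟩
      simp [hs s subset_rfl]

theorem isInternal_prod {M N : Type*} [AddCommGroup M] [Module R M] [AddCommGroup N] [Module R N]
    {A : ℤ → Submodule R M} {B : ℤ → Submodule R N} (hA : DirectSum.IsInternal A)
    (hB : DirectSum.IsInternal B) : DirectSum.IsInternal fun d => (A d).prod (B d) := by
  obtain ⟨P, h1, h2, h3, h4⟩ := (isInternal_iff_proj A).1 hA
  obtain ⟨P', h1', h2', h3', h4'⟩ := (isInternal_iff_proj B).1 hB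
  refine (isInternal_iff_proj _).2 ⟨fun d => (P d).prodMap (P' d), fun d m => ⟨h1 d _, h1' d _⟩,
    fun d m hm => Prod.ext (h2 d _ hm.1) (h2' d _ hm.2),
    fun d e hde m hm => Prod.ext (h3 d e hde _ hm.1) (h3' d e hde _ hm.2), fun m => ?_⟩
  obtain ⟨s, hs⟩ := h4 m.1
  obtain ⟨s', hs'⟩ := h4' m.2
  refine ⟨s ∪ s', fun t ht => ?_⟩
  have ht' := Finset.union_subset_iff.1 ht
  refine Prod.ext ?_ ?_
  · simpa [Prod.fst_sum] using hs t ht'.1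
  · simpa [Prod.snd_sum] using hs' t ht'.2

theorem isInternal_ker {M N : Type*} [AddCommGroup M] [Module R M] [AddCommGroup N] [Module R N]
    {A : ℤ → Submodule R M} {B : ℤ → Submodule R N} (hA : DirectSum.IsInternal A)
    (hB : DirectSum.IsInternal B) (φ : M →ₗ[R] N) (hφ : ∀ d, ∀ f ∈ A d, φ f ∈ B d) :
    DirectSum.IsInternal fun d => (A d).comap (LinearMap.ker φ).subtype := by
  obtain ⟨P, h1, h2, h3, h4⟩ := (isInternal_iff_proj A).1 hA
  obtain ⟨P', h1', h2', h3', h4'⟩ := (isInternal_iff_proj B).1 hB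
  have comm : ∀ d m, φ (P d m) = P' d (φ m) := by
    intro d m
    obtain ⟨s, hs⟩ := h4 m
    have h : P' d (φ m) = ∑ e ∈ insert d s, P' d (φ (P e m)) := by
      rw [← map_sum, ← map_sum, hs _ (Finset.subset_insert d s)]
    rw [h, Finset.sum_eq_single d]
    · exact (h2' d _ (hφ d _ (h1 d m))).symm
    · intro e _ he
      exact h3' d e he.symm _ (hφ e _ (h1 e m))
    · intro hd
      exact absurd (Finset.mem_insert_self d s) hd
  refine (isInternal_iff_proj _).2 ⟨fun d => ((P d) ∘ₗ (LinearMap.ker φ).subtype).codRestrict _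
      fun m => by simp [comm, LinearMap.mem_ker.1 m.2], fun d m => h1 d _,
    fun d m hm => Subtype.ext (h2 d _ hm), fun d e hde m hm => Subtype.ext (h3 d e hde _ hm),
    fun m => ?_⟩
  obtain ⟨s, hs⟩ := h4 m
  refine ⟨s, fun t ht => Subtype.ext ?_⟩
  rw [AddSubmonoidClass.coe_finsetSum]
  exact hs t ht

/-! ### Graded-split surjections and the two quivers -/

section setup

variable {A : GQuiver.{w, u, v} R} {A' : GQuiver.{w, u', v'} R} {A'' : GQuiver.{w, u'', v''} R}

/-- A choice of graded splittings of the surjections `F¹ : A(x, y) → A'(F⁰ x, F⁰ y)`: for all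
objects `x`, `y` of `A`, a right inverse of `F¹` in the category of graded `R`-modules. -/
structure Splitting (F : FormalMorphism A A') where
  s : ∀ x y : A.Ob, A'.Hom (F.obj x) (F.obj y) →ₗ[R] A.Hom x y
  s_mem : ∀ x y d h, h ∈ A'.gr (F.obj x) (F.obj y) d → s x y h ∈ A.gr x y d
  lin_s : ∀ x y h, F.lin x y (s x y h) = h

/-- The graded quiver `K`: the objects of `A`, with arrows `K(x, y) = Ker (F¹ : A(x, y) → …)`. -/
@[reducible] def kerQuiver (F : FormalMorphism A A') : GQuiver.{w, u, v} R where
  Ob := A.Ob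
  Hom x y := LinearMap.ker (F.lin x y)
  gr x y d := (A.gr x y d).comap (LinearMap.ker (F.lin x y)).subtype
  isInternal x y := isInternal_ker (A.isInternal x y) (A'.isInternal _ _) (F.lin x y)
    fun _ _ hf => F.lin_mem hf

/-- The full sub quiver, generated by the objects that satisfy `S`, of the product of two graded
quivers. -/
@[reducible] def subProd (Q : GQuiver.{w, u, v} R) (Q' : GQuiver.{w, u', v'} R)
    (S : Q.Ob × Q'.Ob → Prop) : GQuiver.{w, max u u', max v v'} R where
  Ob := { p : Q.Ob × Q'.Ob // S p }
  Hom p q := Q.Hom p.1.1 q.1.1 × Q'.Hom p.1.2 q.1.2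
  gr p q d := (Q.gr p.1.1 q.1.1 d).prod (Q'.gr p.1.2 q.1.2 d)
  isInternal _ _ := isInternal_prod (Q.isInternal _ _) (Q'.isInternal _ _)

/-- The projection of a sub quiver of a product to the second factor, on chains. -/
def sndChain {Q : GQuiver.{w, u, v} R} {Q' : GQuiver.{w, u', v'} R} {S : Q.Ob × Q'.Ob → Prop}
    {p q : (subProd Q Q' S).Ob} (c : Chain (subProd Q Q' S) p q) : Chain Q' p.1.2 q.1.2 :=
  c.map (Q' := Q') (fun p : (subProd Q Q' S).Ob => p.1.2)
    (fun p q (f : (subProd Q Q' S).Hom p q) => f.2)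

/-- The projection of a sub quiver of a product to the second factor, a strict morphism. -/
def sndMor (Q : GQuiver.{w, u, v} R) (Q' : GQuiver.{w, u', v'} R) (S : Q.Ob × Q'.Ob → Prop) :
    FormalMorphism (subProd Q Q' S) Q' :=
  .ofLinear (fun p => p.1.2) (fun _ _ => LinearMap.snd R _ _) fun _ _ _ _ hf => hf.2

/-- The projection of a sub quiver of a product to the first factor, a strict morphism. -/
def fstMor (Q : GQuiver.{w, u, v} R) (Q' : GQuiver.{w, u', v'} R) (S : Q.Ob × Q'.Ob → Prop) :
    FormalMorphism (subProd Q Q' S) Q :=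
  .ofLinear (fun p => p.1.1) (fun _ _ => LinearMap.fst R _ _) fun _ _ _ _ hf => hf.1

/-- The graded quiver `(K × A')_S`: objects the pairs `(a, F⁰ a)`, arrows `K(a₁, a₂) ⊕ A'(…)`. -/
@[reducible] def KA' (F : FormalMorphism A A') : GQuiver.{w, max u u', max v v'} R :=
  subProd (kerQuiver F) A' fun p => p.2 = F.obj p.1

/-- The graded quiver `(K × A'')_{S'}`: objects the pairs `(x, y)` with `F⁰ x = G⁰ y`, arrows
`K(x₁, x₂) ⊕ A''(y₁, y₂)`. -/
@[reducible] def KA'' (F : FormalMorphism A A') (G : FormalMorphism A'' A') :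
    GQuiver.{w, max u u'', max v v''} R :=
  subProd (kerQuiver F) A'' fun p => F.obj p.1 = G.obj p.2

/-- The projection `(K × A')_S → A'`. -/
def prA' (F : FormalMorphism A A') : FormalMorphism (KA' F) A' := sndMor _ _ _

/-- The projection `(K × A'')_{S'} → A''`. -/
def prA'' (F : FormalMorphism A A') (G : FormalMorphism A'' A') : FormalMorphism (KA'' F G) A'' :=
  sndMor _ _ _

/-- The formal morphism `Id_K × G : (K × A'')_{S'} → (K × A')_S`, `(x, y) ↦ (x, G⁰ y)` on objects,
`(k, a) ↦ (k, G¹ a)` for `n = 1` and `((k₁, a₁), …, (kₙ, aₙ)) ↦ (0, Gⁿ(a₁, …, aₙ))` for `n ≥ 2`. -/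
def idKProd (F : FormalMorphism A A') (G : FormalMorphism A'' A') :
    FormalMorphism (KA'' F G) (KA' F) where
  obj p := ⟨(p.1.1, G.obj p.1.2), p.2.symm⟩
  map c := ((fstMor _ _ _).map c, G.map (sndChain c))
  map_nil p := Prod.ext rfl (G.map_nil p.1.2)
  multilinear p q a b c d r f g := by
    refine Prod.ext ((fstMor _ _ _).multilinear p q a b c d r f g) ?_
    have := G.multilinear _ _ _ _ (sndChain c) (sndChain d) r f.2 g.2
    simpa [sndChain, Chain.map_append, Chain.map] using this
  map_mem c e hc := by
    refine ⟨(fstMor _ _ _).map_mem c e hc, ?_⟩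
    have := G.map_mem (sndChain c) e (Chain.IsHomogeneous.map (Q' := A'')
      (fun p : (KA'' F G).Ob => p.1.2) (fun p q (f : (KA'' F G).Hom p q) => f.2)
      (fun _ _ _ _ hf => hf.2) hc)
    rw [sndChain, Chain.length_map] at this
    exact this

/-- The formal automorphism `Φ` of the graded quiver `A` with `Φ⁰ = Id`, `Φ¹ = Id` and
`Φⁿ = s¹ Fⁿ` for `n ≥ 2`. -/
def Splitting.Phi {F : FormalMorphism A A'} (σ : Splitting F) : FormalMorphism A A where
  obj x := x
  map {x y} c := FormalMorphism.linMap (Q' := A) (fun x => x)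
      (fun x y => LinearMap.id - (σ.s x y).comp (F.lin x y)) c + σ.s x y (F.map c)
  map_nil x := by simp [FormalMorphism.linMap, F.map_nil]
  multilinear x y a b p q r f g := by
    have h1 := FormalMorphism.linMap_multilinear (Q' := A) (fun x => x)
      (fun x y => LinearMap.id - (σ.s x y).comp (F.lin x y)) x y a b p q r f g
    have h2 := F.multilinear x y a b p q r f g
    simp only at h1 h2 ⊢
    rw [h1, h2, map_add, map_smul, smul_add]
    abel
  map_mem {x y} c e hc := by
    refine Submodule.add_mem _ (FormalMorphism.linMap_mem (Q' := A) (fun x => x) _ ?_ c e hc)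
      (σ.s_mem _ _ _ _ (F.map_mem c e hc))
    intro x y d f hf
    exact Submodule.sub_mem _ hf (σ.s_mem _ _ _ _ (F.lin_mem hf))

theorem Splitting.Phi_one {F : FormalMorphism A A'} (σ : Splitting F) {x y : A.Ob}
    (f : A.Hom x y) : σ.Phi.map (.cons f .nil) = f := by
  simp [Splitting.Phi, FormalMorphism.linMap, FormalMorphism.lin_apply]

theorem Splitting.Phi_two {F : FormalMorphism A A'} (σ : Splitting F) {x y z t : A.Ob}
    (f : A.Hom x y) (g : A.Hom y z) (c : Chain A z t) :
    σ.Phi.map (.cons f (.cons g c)) = σ.s x t (F.map (.cons f (.cons g c))) := by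
  simp [Splitting.Phi, FormalMorphism.linMap]

/-- The retraction `r¹ : A(x, y) → K(x, y)` on the kernel that is determined by the splitting. -/
def Splitting.r {F : FormalMorphism A A'} (σ : Splitting F) (x y : A.Ob) :
    A.Hom x y →ₗ[R] (kerQuiver F).Hom x y :=
  (LinearMap.id - (σ.s x y).comp (F.lin x y)).codRestrict _ fun f => by
    simp [σ.lin_s]

/-- The isomorphism of graded quivers `A ≃ (K × A')_S`, `x ↦ (x, F⁰ x)`, `f ↦ (r¹ f, F¹ f)`. -/
def Splitting.iso {F : FormalMorphism A A'} (σ : Splitting F) : FormalMorphism A (KA' F) :=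
  .ofLinear (Q' := KA' F) (fun x => ⟨(x, F.obj x), rfl⟩) (fun x y => (σ.r x y).prod (F.lin x y))
    fun _ _ _ _ hf =>
      ⟨Submodule.sub_mem _ hf (σ.s_mem _ _ _ _ (F.lin_mem hf)), F.lin_mem hf⟩

/-- `D'` is the A∞-structure on `(K × A')_S` obtained from the A∞-structure `D` on `A` by transport
along the isomorphism of graded quivers with formal morphisms
`A → A → (K × A')_S` (first `Φ`, then the isomorphism of graded quivers `A ≃ (K × A')_S`):
it is the only A∞-structure for which this isomorphism is an A∞-functor. -/
def Splitting.IsTransported {F : FormalMorphism A A'} (σ : Splitting F) (D : AInfStructure A)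
    (D' : AInfStructure (KA' F)) : Prop :=
  IsAInfFunctor D D' (σ.iso.comp σ.Phi) ∧
    ∀ E : AInfStructure (KA' F), IsAInfFunctor D E (σ.iso.comp σ.Phi) → E = D'

end setup

end

end AInfinity

open AInfinity

namespace AInfinity

universe w u v u' v' u'' v''

variable {R : Type w} [CommRing R]

namespace Chain

variable {Q : GQuiver.{w, u, v} R} {Q' : GQuiver.{w, u', v'} R}

/-! The computation takes place in the bar construction. Operations $m$ amount to a coderivation of
the coalgebra of chains under deconcatenation, and a formal morphism to a coalgebra map. An
A∞-structure is a coderivation of square zero, and an A∞-functor is a coalgebra map that intertwines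
two of them. The coalgebra itself is not built. Instead, functions `φ` on chains are precomposed
with these maps, which gives `bdry m φ` and `pull o F φ`. The hypotheses `stasheff` and
`IsAInfFunctor` only give the identities after projection to chains of length one.
`AInfStructure.bdry_bdry` and `FormalMorphism.bdry_pull` extend them to every multilinear `φ`, and
`FormalMorphism.pull_comp` is functoriality.

The structure on $(K\times A')_S$: $\Phi$ has identity linear part, so it is inverted by recursion
on the length of chains (`IsUnipotent.exists_inverse`). Conjugating by $\Phi$ and then relabelling
along $f\mapsto(r^1f,F^1f)$ gives the structure, and invertibility gives its uniqueness. Since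
$F^1\Phi^n=F^n$ for all $n$ (`Splitting.lin_Phi_map`), $F$ is $\Phi$ followed by the strict morphism
$F^1$. In the new coordinates $F$ therefore becomes the projection, and cancelling $\Phi$ shows that
the projection is an A∞-functor.

The structure on $(K\times A'')_{S'}$: once $F$ is a strict projection, the pullback can be written
down. The $K$-component of the operation is that of $(K\times A')_S$ pulled back along
$\mathrm{Id}_K\times G$, and the $A''$-component is the operation of $A''$.
`bdry_pullbackOp_idKProd` shows that $\mathrm{Id}_K\times G$ intertwines the operations. In $K$ this
holds because the morphism is strict there, and in $A'$ because $G$ and the projection are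
A∞-functors and the square commutes. The A∞-relation then holds in each component separately: it is
inherited from $A''$ in one, and from $(K\times A')_S$ through `bdry_pull` in the other. -/

theorem append_nil : ∀ {x y : Q.Ob} (p : Chain Q x y), p.append nil = p
  | _, _, nil => rfl
  | _, _, cons f p => congrArg (cons f) (append_nil p)

/-! ### Deconcatenation, bar coderivations and bar morphisms, acting on functions of chains. -/

section sums

variable {M : Type*} [AddCommMonoid M]

/-- The sum of `ψ` over all the ways of cutting a chain in two. -/
def cutSum {x z : Q.Ob} (ψ : ∀ y : Q.Ob, Chain Q x y → Chain Q y z → M) (c : Chain Q x z) : M :=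
  (c.cuts.map fun s => ψ s.mid s.left s.right).sum

/-- The pullback of a function on chains along the coderivation of the bar construction
induced by `m`. -/
noncomputable def bdry (m : ∀ {x y : Q.Ob}, Chain Q x y → Q.Hom x y) {x z : Q.Ob}
    (φ : Chain Q x z → M) (c : Chain Q x z) : M :=
  ((barD m c).map φ).sum

/-- The pullback of a function on chains along the map of bar constructions induced by `F`. -/
def pull (o : Q.Ob → Q'.Ob) (F : ∀ {x y : Q.Ob}, Chain Q x y → Q'.Hom (o x) (o y)) {x z : Q.Ob}
    (φ : Chain Q' (o x) (o z) → M) (c : Chain Q x z) : M :=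
  ((barF o F c).map φ).sum

theorem cutSum_nil {x : Q.Ob} (ψ : ∀ y : Q.Ob, Chain Q x y → Chain Q y x → M) :
    cutSum ψ nil = ψ _ nil nil := by
  simp [cutSum, cuts]

theorem cutSum_cons {x y z : Q.Ob} (ψ : ∀ y : Q.Ob, Chain Q x y → Chain Q y z → M)
    (f : Q.Hom x y) (c : Chain Q y z) :
    cutSum ψ (cons f c) = ψ _ nil (cons f c) + cutSum (fun y l r => ψ y (cons f l) r) c := by
  simp [cutSum, cuts, Function.comp_def]

theorem cutSum_congr {x z : Q.Ob} {ψ ψ' : ∀ y : Q.Ob, Chain Q x y → Chain Q y z → M}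
    (c : Chain Q x z)
    (h : ∀ y (l : Chain Q x y) (r : Chain Q y z), l.length + r.length = c.length →
      ψ y l r = ψ' y l r) : cutSum ψ c = cutSum ψ' c := by
  induction c with
  | nil => simpa [cutSum_nil] using h _ nil nil rfl
  | cons f c ih =>
    rw [cutSum_cons, cutSum_cons, h _ nil (cons f c) (by simp [length])]
    congr 1
    exact ih fun y l r hlr => h _ _ _ (by simp only [length]; omega)

theorem cutSum_add {x z : Q.Ob} (ψ ψ' : ∀ y : Q.Ob, Chain Q x y → Chain Q y z → M)
    (c : Chain Q x z) :
    cutSum (fun y l r => ψ y l r + ψ' y l r) c = cutSum ψ c + cutSum ψ' c :=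
  List.sum_map_add

theorem cutSum_zero {x z : Q.Ob} (c : Chain Q x z) :
    cutSum (fun _ _ _ => (0 : M)) c = 0 := by
  simp [cutSum]

theorem map_cutSum {N : Type*} [AddCommMonoid N] (g : M →+ N) {x z : Q.Ob}
    (ψ : ∀ y : Q.Ob, Chain Q x y → Chain Q y z → M) (c : Chain Q x z) :
    g (cutSum ψ c) = cutSum (fun y l r => g (ψ y l r)) c := by
  simp [cutSum, map_list_sum, Function.comp_def]

/-- Coassociativity of the deconcatenation of chains. -/
theorem cutSum_cutSum {x z : Q.Ob} (c : Chain Q x z) :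
    ∀ ψ : ∀ a b : Q.Ob, Chain Q x a → Chain Q a b → Chain Q b z → M,
    cutSum (fun a l r => cutSum (fun b u v => ψ a b l u v) r) c =
      cutSum (fun b l r => cutSum (fun a u v => ψ a b u v r) l) c := by
  induction c with
  | nil => intro ψ; simp [cutSum_nil]
  | cons f c ih =>
    intro ψ
    simp only [cutSum_cons, cutSum_nil, cutSum_add]
    rw [ih fun a b l u v => ψ a b (cons f l) u v, add_assoc]

variable (m : ∀ {x y : Q.Ob}, Chain Q x y → Q.Hom x y)

theorem bdry_eq_cutSum {x z : Q.Ob} (φ : Chain Q x z → M) (c : Chain Q x z) :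
    bdry m φ c = cutSum (fun _ l r =>
      cutSum (fun _ u v => φ (l.signed.append (cons (m u) v))) r) c := by
  simp only [bdry, barD, cutSum]
  induction c.cuts with
  | nil => simp
  | cons s S ih => simp [ih, Function.comp_def]

theorem bdry_nil {x : Q.Ob} (φ : Chain Q x x → M) : bdry m φ nil = φ (cons (m nil) nil) := by
  simp [bdry_eq_cutSum, cutSum_nil, signed, map, append]

/-- Recursion behind the later inductions: either the operation takes an initial block (possibly
empty), or it passes over the first arrow, which then acquires its Koszul sign. -/
theorem bdry_cons {x y z : Q.Ob} (φ : Chain Q x z → M) (f : Q.Hom x y) (c : Chain Q y z) :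
    bdry m φ (cons f c) = cutSum (fun _ u v => φ (cons (m u) v)) (cons f c) +
      bdry m (fun t => φ (cons (Q.sgn x y f) t)) c := by
  rw [bdry_eq_cutSum, cutSum_cons, bdry_eq_cutSum]
  rfl

theorem bdry_add {x z : Q.Ob} (φ φ' : Chain Q x z → M) (c : Chain Q x z) :
    bdry m (fun t => φ t + φ' t) c = bdry m φ c + bdry m φ' c :=
  List.sum_map_add

theorem map_bdry {N : Type*} [AddCommMonoid N] (g : M →+ N) {x z : Q.Ob}
    (φ : Chain Q x z → M) (c : Chain Q x z) :
    g (bdry m φ c) = bdry m (fun t => g (φ t)) c := by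
  simp [bdry, map_list_sum, Function.comp_def]

/-- The bar differential is a coderivation for the deconcatenation. -/
theorem bdry_cutSum {x z : Q.Ob} (c : Chain Q x z) :
    ∀ ψ : ∀ y : Q.Ob, Chain Q x y → Chain Q y z → M,
    bdry m (fun t => cutSum ψ t) c =
      cutSum (fun y l r => bdry m (fun t => ψ y t r) l + bdry m (fun t => ψ y l.signed t) r) c := by
  induction c with
  | nil => intro ψ; simp [bdry_nil, cutSum_nil, cutSum_cons, signed, map, add_comm]
  | cons f c ih =>
    intro ψ
    -- For the terms where the operation takes an initial block, removing the block and then cutting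
    -- the rest is the same as cutting first and taking the block inside the left piece.
    have h1 := cutSum_cutSum (cons f c) (fun _ b l u v => ψ b (cons (m l) u) v)
    rw [bdry_cons]
    simp only [cutSum_cons (fun y l r => ψ y l r), bdry_add]
    rw [ih]
    rw [cutSum_add, h1]
    rw [cutSum_cons (fun y l r => bdry m (fun t => ψ y t r) l + bdry m (fun t => ψ y l.signed t) r)]
    rw [bdry_nil, bdry_cons, cutSum_cons (fun _ l r => cutSum _ l), cutSum_nil]
    simp only [bdry_cons, cutSum_add, signed, map]
    abel

variable (o : Q.Ob → Q'.Ob) (F : ∀ {x y : Q.Ob}, Chain Q x y → Q'.Hom (o x) (o y))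

theorem pull_nil {x : Q.Ob} (φ : Chain Q' (o x) (o x) → M) :
    pull o F φ (nil : Chain Q x x) = φ nil := by
  simp [pull, barF]

/-- Removes the accumulator of `barFAux`: the first block is `p` extended by an initial piece `l` of
the chain, and the remainder is subdivided independently. -/
theorem sum_barFAux {y z : Q.Ob} (c : Chain Q y z) :
    ∀ {x : Q.Ob} (φ : Chain Q' (o x) (o z) → M) (p : Chain Q x y),
    ((barFAux o F p c).map φ).sum =
      cutSum (fun _ l r => pull o F (fun t => φ (cons (F (p.append l)) t)) r) c := by
  induction c with
  | nil =>
    intro x φ p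
    simp [barFAux, cutSum_nil, pull_nil, append_nil]
  | cons f c ih =>
    intro x φ p
    have h1 : pull o F (fun t => φ (cons (F p) t)) (cons f c) = _ := ih _ (cons f nil)
    rw [cutSum_cons, append_nil, h1, barFAux, List.map_append, List.sum_append, ih,
      List.map_map, ih, add_comm]
    simp only [append_assoc, append, Function.comp_def]

theorem pull_cons {x y z : Q.Ob} (φ : Chain Q' (o x) (o z) → M) (f : Q.Hom x y)
    (c : Chain Q y z) :
    pull o F φ (cons f c) =
      cutSum (fun _ l r => pull o F (fun t => φ (cons (F (cons f l)) t)) r) c :=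
  sum_barFAux o F c φ (cons f nil)

theorem pull_add {x z : Q.Ob} (φ φ' : Chain Q' (o x) (o z) → M) (c : Chain Q x z) :
    pull o F (fun t => φ t + φ' t) c = pull o F φ c + pull o F φ' c :=
  List.sum_map_add

theorem map_pull {N : Type*} [AddCommMonoid N] (g : M →+ N) {x z : Q.Ob}
    (φ : Chain Q' (o x) (o z) → M) (c : Chain Q x z) :
    g (pull o F φ c) = pull o F (fun t => g (φ t)) c := by
  simp [pull, map_list_sum, Function.comp_def]

/-- The map of bar constructions is a morphism of coalgebras for the deconcatenation. -/
theorem pull_cutSum {x z : Q.Ob} (c : Chain Q x z)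
    (ψ : ∀ y : Q'.Ob, Chain Q' (o x) y → Chain Q' y (o z) → M) :
    pull o F (fun t => cutSum ψ t) c =
      cutSum (fun y l r => pull o F (fun u => pull o F (fun v => ψ (o y) u v) r) l) c := by
  induction hn : c.length using Nat.strong_induction_on generalizing x with
  | _ n ih =>
  cases c with
  | nil => simp [pull_nil, cutSum_nil]
  | cons f c =>
    rw [pull_cons, cutSum_cons]
    simp only [cutSum_cons ψ, pull_add]
    rw [cutSum_add, pull_nil, pull_cons o F _ f c]
    congr 1
    -- The first block contains `f`, so the remainder is strictly shorter and the induction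
    -- hypothesis applies. Coassociativity then regroups the first block with the left piece.
    rw [cutSum_congr c (fun y l r hlr => ih r.length (by simp only [length] at hn; omega) r
      (fun y' u v => ψ y' (cons (F (cons f l)) u) v) rfl)]
    rw [cutSum_cutSum c (fun a b l u v => pull o F (fun u' => pull o F (fun v' =>
      ψ (o b) (cons (F (cons f l)) u') v') v) u)]
    simp only [pull_cons o F _ f]

end sums

/-! ### Multilinear functions of chains and the Koszul sign rule. -/

section multilinear

variable {M : Type*} [AddCommGroup M] [Module R M]

theorem IsMultilinear.head_add {x y z : Q.Ob} {φ : Chain Q x z → M} (h : IsMultilinear φ)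
    (f g : Q.Hom x y) (t : Chain Q y z) :
    φ (Chain.cons (f + g) t) = φ (Chain.cons f t) + φ (Chain.cons g t) := by
  simpa [append] using h _ _ .nil t 1 f g

theorem IsMultilinear.head_zero {x y z : Q.Ob} {φ : Chain Q x z → M} (h : IsMultilinear φ)
    (t : Chain Q y z) : φ (Chain.cons (0 : Q.Hom x y) t) = 0 := by
  simpa using h.head_add 0 0 t

theorem IsMultilinear.head_smul {x y z : Q.Ob} {φ : Chain Q x z → M} (h : IsMultilinear φ)
    (r : R) (f : Q.Hom x y) (t : Chain Q y z) :
    φ (Chain.cons (r • f) t) = r • φ (Chain.cons f t) := by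
  have := h _ _ .nil t r f 0
  simp only [append, add_zero, h.head_zero] at this
  exact this

theorem IsMultilinear.head_neg {x y z : Q.Ob} {φ : Chain Q x z → M} (h : IsMultilinear φ)
    (f : Q.Hom x y) (t : Chain Q y z) :
    φ (Chain.cons (-f) t) = - φ (Chain.cons f t) := by
  simpa using h.head_smul (-1) f t

theorem IsMultilinear.head_zsmul {x y z : Q.Ob} {φ : Chain Q x z → M} (h : IsMultilinear φ)
    (n : ℤ) (f : Q.Hom x y) (t : Chain Q y z) :
    φ (Chain.cons (n • f) t) = n • φ (Chain.cons f t) := by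
  rw [← Int.cast_smul_eq_zsmul R, h.head_smul, Int.cast_smul_eq_zsmul]

theorem IsMultilinear.head_list_sum {x y z : Q.Ob} {φ : Chain Q x z → M} (h : IsMultilinear φ)
    (L : List (Q.Hom x y)) (t : Chain Q y z) :
    φ (Chain.cons L.sum t) = (L.map fun f => φ (Chain.cons f t)).sum := by
  induction L with
  | nil => simp [h.head_zero]
  | cons f L ih => simp [h.head_add, ih]

theorem IsMultilinear.comp_linear {N : Type*} [AddCommGroup N] [Module R N] {x z : Q.Ob}
    {φ : Chain Q x z → M} (h : IsMultilinear φ) (g : M →ₗ[R] N) :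
    IsMultilinear fun c => g (φ c) := by
  intro a b p q r f f'
  simp only [h a b p q r f f', map_add, map_smul]

theorem IsMultilinear.sub {x z : Q.Ob} {φ φ' : Chain Q x z → M} (h : IsMultilinear φ)
    (h' : IsMultilinear φ') : IsMultilinear fun c => φ c - φ' c := by
  intro a b p q r f f'
  simp only [h a b p q r f f', h' a b p q r f f', smul_sub]
  abel

theorem IsMultilinear.comp_map {x z : Q.Ob} (o : Q.Ob → Q'.Ob)
    (g : ∀ x y : Q.Ob, Q.Hom x y →ₗ[R] Q'.Hom (o x) (o y)) {φ : Chain Q' (o x) (o z) → M}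
    (h : IsMultilinear φ) : IsMultilinear fun c : Chain Q x z => φ (c.map o fun x y => g x y) := by
  intro a b p q r f f'
  simp only [map_append, map, map_add, map_smul]
  exact h _ _ _ _ r _ _

/-- A multilinear function is determined by its values on chains of homogeneous arrows. -/
theorem IsMultilinear.eq_zero_of_homogeneous {x z : Q.Ob} {φ : Chain Q x z → M}
    (h : IsMultilinear φ) (h0 : ∀ c e, c.IsHomogeneous e → φ c = 0) (c : Chain Q x z) :
    φ c = 0 := by
  induction c with
  | nil => exact h0 _ _ .nil
  | @cons x y z f c ih =>
    have hf : f ∈ ⨆ d, Q.gr x y d := by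
      rw [(Q.isInternal x y).submodule_iSup_eq_top]; trivial
    induction hf using Submodule.iSup_induction' with
    | mem d g hg => exact ih (h.cons g) fun c e hc => h0 _ _ (.cons hg hc)
    | zero => exact h.head_zero c
    | add a b _ _ ha hb => rw [h.head_add, ha, hb, add_zero]

end multilinear

theorem signed_multilinear {M : Type*} [AddCommGroup M] [Module R M] {x z : Q.Ob}
    {φ : Chain Q x z → M} (h : IsMultilinear φ) : IsMultilinear fun c => φ c.signed :=
  h.comp_map (fun x => x) (fun x y => Q.sgn x y)

theorem IsHomogeneous.apply_signed {M : Type*} [AddCommGroup M] [Module R M] {x z : Q.Ob}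
    {c : Chain Q x z} {e : ℤ} (hc : c.IsHomogeneous e) {φ : Chain Q x z → M}
    (h : IsMultilinear φ) : φ c.signed = ((e - c.length).negOnePow : ℤ) • φ c := by
  induction hc with
  | nil => simp [signed, Chain.map, length]
  | @cons x y z f c d e hf hc ih =>
    have h1 := ih (h.cons (Q.sgn x y f))
    simp only [signed, Chain.map] at h1 ⊢
    rw [h1, Q.sgn_of_mem hf, h.head_zsmul,
      smul_smul, ← Units.val_mul, ← Int.negOnePow_add]
    congr 3
    simp [length]
    ring

end Chain

theorem GQuiver.sgn_sgn (Q : GQuiver.{w, u, v} R) {x y : Q.Ob} (f : Q.Hom x y) :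
    Q.sgn x y (Q.sgn x y f) = f := by
  have hf : f ∈ ⨆ d, Q.gr x y d := by
    rw [(Q.isInternal x y).submodule_iSup_eq_top]; trivial
  induction hf using Submodule.iSup_induction' with
  | mem d g hg =>
    rw [Q.sgn_of_mem hg, map_zsmul, Q.sgn_of_mem hg, smul_smul, ← Units.val_mul,
      ← Int.negOnePow_add, Int.negOnePow_even _ (Even.add_self _)]
    simp
  | zero => simp
  | add a b _ _ ha hb => rw [map_add, map_add, ha, hb]

namespace Chain

variable {Q : GQuiver.{w, u, v} R} {Q' : GQuiver.{w, u', v'} R}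

/-- The Koszul sign rule for a graded multilinear function. -/
theorem IsMultilinear.sgn_apply {x z : Q.Ob} {x' z' : Q'.Ob} {φ : Chain Q x z → Q'.Hom x' z'}
    (h : IsMultilinear φ) (k : ℤ)
    (hk : ∀ c e, c.IsHomogeneous e → φ c ∈ Q'.gr x' z' (e + k - c.length)) (c : Chain Q x z) :
    Q'.sgn x' z' (φ c) = ((k - 1).negOnePow : ℤ) • φ c.signed := by
  have hm : IsMultilinear fun c => Q'.sgn x' z' (φ c) - ((k - 1).negOnePow : ℤ) • φ c.signed :=
    (h.comp_linear (Q'.sgn x' z')).sub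
      ((signed_multilinear h).comp_linear (((k - 1).negOnePow : ℤ) • LinearMap.id))
  rw [← sub_eq_zero]
  refine hm.eq_zero_of_homogeneous (fun c e hc => ?_) c
  rw [hc.apply_signed h, Q'.sgn_of_mem (hk c e hc), smul_smul, ← Units.val_mul,
      ← Int.negOnePow_add, sub_eq_zero]
  congr 3
  ring

end Chain

open Chain

/-- In the shifted grading formal morphisms are even, so no sign appears here; the operations are
odd, which gives the minus sign in `AInfStructure.m_signed`. -/
theorem FormalMorphism.map_signed {Q : GQuiver.{w, u, v} R} {Q' : GQuiver.{w, u', v'} R}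
    (F : FormalMorphism Q Q') {x y : Q.Ob} (c : Chain Q x y) :
    F.map c.signed = Q'.sgn _ _ (F.map c) := by
  simp [(F.multilinear x y).sgn_apply 1 F.map_mem c]

theorem AInfStructure.m_signed {Q : GQuiver.{w, u, v} R} (D : AInfStructure Q) {x y : Q.Ob}
    (c : Chain Q x y) : D.m c.signed = - Q.sgn _ _ (D.m c) := by
  simp [(D.multilinear x y).sgn_apply 2 D.m_mem c]

/-! ### Square-zero, intertwining and functoriality in the bar construction. -/

namespace Chain

variable {Q : GQuiver.{w, u, v} R} {Q' : GQuiver.{w, u', v'} R}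
variable {M : Type*} [AddCommGroup M] [Module R M]

theorem IsMultilinear.bdry_head {x y z : Q.Ob} {φ : Chain Q x z → M} (h : IsMultilinear φ)
    (m m' : ∀ {x y : Q.Ob}, Chain Q x y → Q.Hom x y) (l : Chain Q x y) (r : Chain Q y z) :
    bdry m (fun t => φ (Chain.cons (m' t) r)) l = φ (Chain.cons (bdry m (fun t => m' t) l) r) := by
  simp only [bdry, h.head_list_sum, List.map_map, Function.comp_def]

theorem IsMultilinear.bdry_neg_head {x y z : Q.Ob} {φ : Chain Q x z → M} (h : IsMultilinear φ)
    (m : ∀ {x y : Q.Ob}, Chain Q x y → Q.Hom x y) (f : Q.Hom x y) (r : Chain Q y z) :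
    bdry m (fun t => φ (Chain.cons (-f) t)) r = - bdry m (fun t => φ (Chain.cons f t)) r := by
  simp only [h.head_neg]
  exact (map_bdry m (-AddMonoidHom.id M) (fun t => φ (Chain.cons f t)) r).symm

theorem IsMultilinear.pull_head_zero {x z : Q.Ob} {a : Q'.Ob} (o : Q.Ob → Q'.Ob)
    (F : ∀ {x y : Q.Ob}, Chain Q x y → Q'.Hom (o x) (o y)) {φ : Chain Q' a (o z) → M}
    (h : IsMultilinear φ) (r : Chain Q x z) :
    pull o F (fun t => φ (Chain.cons 0 t)) r = 0 := by
  simp [h.head_zero, pull]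

theorem IsMultilinear.pull_head_list_sum {x z : Q.Ob} {a : Q'.Ob} (o : Q.Ob → Q'.Ob)
    (F : ∀ {x y : Q.Ob}, Chain Q x y → Q'.Hom (o x) (o y)) {φ : Chain Q' a (o z) → M}
    (h : IsMultilinear φ) {ι : Type*} (L : List ι) (g : ι → Q'.Hom a (o x)) (r : Chain Q x z) :
    (L.map fun i => pull o F (fun t => φ (Chain.cons (g i) t)) r).sum =
      pull o F (fun t => φ (Chain.cons (L.map g).sum t)) r := by
  induction L with
  | nil => simp [h.pull_head_zero]
  | cons i L ih => simp only [List.map_cons, List.sum_cons, h.head_add, pull_add, ih]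

/-- The operation always contributes one arrow, even when it is applied to an empty block.
Identities that fail on the empty chain can therefore still be used under `bdry`. -/
theorem barD_ne_nil {x y : Q.Ob} (m : ∀ {x y : Q.Ob}, Chain Q x y → Q.Hom x y) (c : Chain Q x y) :
    ∀ t ∈ barD m c, 0 < t.length := by
  intro t ht
  simp only [barD, List.mem_flatMap, List.mem_map] at ht
  obtain ⟨s, -, u, -, rfl⟩ := ht
  simp [length_append, length]

theorem bdry_congr {M : Type*} [AddCommMonoid M] {x y : Q.Ob}
    (m : ∀ {x y : Q.Ob}, Chain Q x y → Q.Hom x y) (c : Chain Q x y)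
    {φ φ' : Chain Q x y → M} (h : ∀ t, 0 < t.length → φ t = φ' t) :
    bdry m φ c = bdry m φ' c := by
  unfold bdry
  congr 1
  exact List.map_congr_left fun t ht => h t (barD_ne_nil m c t ht)

theorem pull_zero {M : Type*} [AddCommMonoid M] (o : Q.Ob → Q'.Ob)
    (F : ∀ {x y : Q.Ob}, Chain Q x y → Q'.Hom (o x) (o y)) {x z : Q.Ob} (r : Chain Q x z) :
    pull o F (fun _ => (0 : M)) r = 0 := by
  simp [pull]

theorem bdry_zero {M : Type*} [AddCommMonoid M] (m : ∀ {x y : Q.Ob}, Chain Q x y → Q.Hom x y)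
    {x z : Q.Ob} (r : Chain Q x z) : bdry m (fun _ => (0 : M)) r = 0 := by
  simp [bdry]

theorem IsMultilinear.pull_pull_head_list_sum {Q'' : GQuiver.{w, u'', v''} R}
    (F : FormalMorphism Q Q') (G : FormalMorphism Q' Q'') {x z : Q.Ob} {a : Q''.Ob}
    {φ : Chain Q'' a (G.obj (F.obj z)) → M} (h : IsMultilinear φ) {ι : Type*} (L : List ι)
    (g : ι → Q''.Hom a (G.obj (F.obj x))) (r : Chain Q x z) :
    (L.map fun i => pull F.obj F.map
        (fun v => pull G.obj G.map (fun t => φ (Chain.cons (g i) t)) v) r).sum =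
      pull F.obj F.map
        (fun v => pull G.obj G.map (fun t => φ (Chain.cons (L.map g).sum t)) v) r := by
  induction L with
  | nil => simp [h.pull_head_zero, pull_zero]
  | cons i L ih => simp only [List.map_cons, List.sum_cons, h.head_add, pull_add, ih]

end Chain

/-- The bar differential of an A∞-structure squares to zero. -/
theorem AInfStructure.bdry_bdry {Q : GQuiver.{w, u, v} R} (D : AInfStructure Q)
    {M : Type*} [AddCommGroup M] [Module R M] {x z : Q.Ob} {φ : Chain Q x z → M}
    (h : IsMultilinear φ) (c : Chain Q x z) : bdry D.m (fun t => bdry D.m φ t) c = 0 := by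
  -- Apply the differential to the terms in which the operation acts on an initial block. A second
  -- operation meeting that block cancels by the A∞-relation; one to its right survives with a minus
  -- sign, since the operation is odd.
  have key : ∀ {x z : Q.Ob} {φ : Chain Q x z → M} (_ : IsMultilinear φ) (C : Chain Q x z),
      bdry D.m (fun t => cutSum (fun _ u v => φ (cons (D.m u) v)) t) C =
        - cutSum (fun _ l r => bdry D.m (fun t => φ (cons (Q.sgn _ _ (D.m l)) t)) r) C := by
    intro x z φ h C
    rw [bdry_cutSum]
    have h2 := fun y (l : Chain Q x y) => D.stasheff l
    simp only [h.bdry_head, D.m_signed, h.bdry_neg_head]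
    simp only [bdry, h2, h.head_zero, zero_add]
    exact (map_cutSum (-AddMonoidHom.id M) _ C).symm
  induction c with
  | nil =>
    have h1 := key h nil
    simp only [bdry_nil, cutSum_nil] at h1
    simp only [bdry_nil, bdry_cons, h1, neg_add_cancel]
  | cons f c ih =>
    have h1 := key h (cons f c)
    rw [bdry_cons] at h1
    rw [bdry_cons]
    -- Two nested operations that both pass over `f` apply the sign involution twice, so the
    -- induction hypothesis removes them. The remaining terms are the two sides of `key`.
    simp only [bdry_cons _ φ, bdry_add, cutSum_add, Q.sgn_sgn, ih (h.cons f), add_zero]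
    rw [add_right_comm, h1, neg_add_cancel]

namespace FormalMorphism

variable {Q : GQuiver.{w, u, v} R} {Q' : GQuiver.{w, u', v'} R} {Q'' : GQuiver.{w, u'', v''} R}
variable {M : Type*} [AddCommGroup M] [Module R M]

/-- Since `F` vanishes on the empty chain, an empty first block may be allowed. This puts the
pullback in the form of a sum over all cuts, to which the coderivation rule applies. It is false for
the empty chain. -/
theorem pull_cons_eq_cutSum (F : FormalMorphism Q Q') {x y z : Q.Ob}
    {φ : Chain Q' (F.obj x) (F.obj z) → M} (h : IsMultilinear φ) (f : Q.Hom x y) (c : Chain Q y z) :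
    pull F.obj F.map φ (cons f c) =
      cutSum (fun _ l r => pull F.obj F.map (fun t => φ (cons (F.map l) t)) r) (cons f c) := by
  rw [cutSum_cons, pull_cons, F.map_nil, h.pull_head_zero, zero_add]

theorem pull_multilinear (F : FormalMorphism Q Q') {x z : Q.Ob}
    {φ : Chain Q' (F.obj x) (F.obj z) → M} (h : IsMultilinear φ) :
    IsMultilinear fun c : Chain Q x z => pull F.obj F.map φ c :=
  F.sum_barF_multilinear φ h

/-- If a formal morphism intertwines two families of operations then the map of bar constructions
intertwines the coderivations. -/
theorem bdry_pull (F : FormalMorphism Q Q') (m : ∀ {x y : Q.Ob}, Chain Q x y → Q.Hom x y)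
    (m' : ∀ {x y : Q'.Ob}, Chain Q' x y → Q'.Hom x y)
    (hF : ∀ {x y : Q.Ob} (c : Chain Q x y),
      bdry m (fun t => F.map t) c = pull F.obj F.map (fun t => m' t) c)
    {x z : Q.Ob} {φ : Chain Q' (F.obj x) (F.obj z) → M} (h : IsMultilinear φ) (c : Chain Q x z) :
    bdry m (fun t => pull F.obj F.map φ t) c = pull F.obj F.map (fun t => bdry m' φ t) c := by
  induction hn : c.length using Nat.strong_induction_on generalizing x with
  | _ n ih =>
  have h1 : bdry m (fun t => pull F.obj F.map φ t) c =
      cutSum (fun _ l r => pull F.obj F.map (fun u => pull F.obj F.map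
          (fun v => φ (cons (m' u) v)) r) l +
        bdry m (fun t => pull F.obj F.map
          (fun v => φ (cons (Q'.sgn _ _ (F.map l)) v)) t) r) c := by
    -- The differential acts either inside the first block, where `hF` applies, or on the remainder,
    -- after the sign of the first block.
    rw [bdry_congr m c (φ' := fun t =>
      cutSum (fun _ l r => pull F.obj F.map (fun t => φ (cons (F.map l) t)) r) t), bdry_cutSum]
    · simp only [F.map_signed]
      congr 1
      funext y l r
      congr 1
      unfold bdry
      rw [h.pull_head_list_sum]
      conv_rhs => unfold pull
      conv_rhs =>
        enter [1]
        change List.map (fun i => pull F.obj F.map (fun t => φ (cons (m' i) t)) r) _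
      rw [h.pull_head_list_sum]
      have := hF l
      unfold bdry pull at this
      rw [this]
    · intro t ht
      cases t with
      | nil => simp [length] at ht
      | cons f t => exact F.pull_cons_eq_cutSum h f t
  rw [h1, cutSum_add]
  cases c with
  | nil =>
    simp [cutSum_nil, pull_nil, bdry_nil, F.map_nil, h.head_zero, pull_zero]
  | cons f c =>
    rw [pull_cons]
    simp only [bdry_cons m' φ, pull_add, cutSum_add]
    congr 1
    · rw [← pull_cutSum F.obj F.map (cons f c) fun _ u v => φ (cons (m' u) v), pull_cons]
    -- The term with an empty first block is zero; in the others the remainder is strictly shorter,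
    -- as the induction requires.
    · rw [cutSum_cons, F.map_nil]
      simp only [map_zero, h.pull_head_zero]
      rw [cutSum_congr c (fun y l r hlr => ih r.length (by simp only [length] at hn; omega)
        (h.cons _) r rfl), bdry_zero, zero_add]

/-- The map of bar constructions induced by a composition. -/
theorem pull_comp (G : FormalMorphism Q' Q'') (F : FormalMorphism Q Q') {x z : Q.Ob}
    {φ : Chain Q'' (G.obj (F.obj x)) (G.obj (F.obj z)) → M} (h : IsMultilinear φ)
    (c : Chain Q x z) :
    pull (fun x => G.obj (F.obj x)) (fun c => pull F.obj F.map (fun t => G.map t) c) φ c =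
      pull F.obj F.map (fun t => pull G.obj G.map φ t) c := by
  induction hn : c.length using Nat.strong_induction_on generalizing x with
  | _ n ih =>
  cases c with
  | nil => simp only [pull_nil]
  | cons f c =>
    have h1 := pull_cutSum F.obj F.map (cons f c)
      (fun y u v => pull G.obj G.map (fun t => φ (cons (G.map u) t)) v)
    rw [pull_cons, cutSum_cons, pull_nil, G.map_nil] at h1
    simp only [h.pull_head_zero] at h1
    rw [pull_cons, pull_cons]
    simp only [G.pull_cons_eq_cutSum h]
    rw [h1, cutSum_congr c (fun y l r hlr => ih r.length (by simp only [length] at hn; omega)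
        (h.cons _) r rfl)]
    rw [pull_zero, zero_add]
    congr 1
    funext y l r
    exact (h.pull_pull_head_list_sum F G _ _ r).symm

end FormalMorphism

/-! ### Strict morphisms and projections to chains of length one. -/

namespace Chain

variable {Q : GQuiver.{w, u, v} R} {Q' : GQuiver.{w, u', v'} R}

theorem map_id : ∀ {x y : Q.Ob} (c : Chain Q x y),
    c.map (Q' := Q) (fun x => x) (fun _ _ f => f) = c
  | _, _, nil => rfl
  | _, _, cons f c => congrArg (cons f) (map_id c)

section strict

variable (o : Q.Ob → Q'.Ob) (g : ∀ x y : Q.Ob, Q.Hom x y → Q'.Hom (o x) (o y))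

theorem cutSum_map {M : Type*} [AddCommMonoid M] {x z : Q.Ob} (c : Chain Q x z) :
    ∀ ψ : ∀ y : Q'.Ob, Chain Q' (o x) y → Chain Q' y (o z) → M,
    cutSum ψ (c.map o g) = cutSum (fun y l r => ψ (o y) (l.map o g) (r.map o g)) c := by
  induction c with
  | nil => intro ψ; simp [cutSum_nil, map]
  | cons f c ih =>
    intro ψ
    rw [map, cutSum_cons, ih, cutSum_cons]
    rfl

theorem bdry_map (m : ∀ {x y : Q.Ob}, Chain Q x y → Q.Hom x y)
    (m' : ∀ {x y : Q'.Ob}, Chain Q' x y → Q'.Hom x y)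
    (hs : ∀ x y f, Q'.sgn _ _ (g x y f) = g x y (Q.sgn x y f))
    (hm : ∀ {x y : Q.Ob} (c : Chain Q x y), m' (c.map o g) = g x y (m c))
    {M : Type*} [AddCommMonoid M] {x z : Q.Ob} (c : Chain Q x z) :
    ∀ φ : Chain Q' (o x) (o z) → M,
    bdry m' φ (c.map o g) = bdry m (fun t => φ (t.map o g)) c := by
  induction c with
  | nil => intro φ; simp only [map, bdry_nil, ← hm]
  | cons f c ih =>
    intro φ
    have h1 := cutSum_map o g (cons f c) (fun _ u v => φ (cons (m' u) v))
    simp only [hm] at h1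
    simp only [map] at h1
    simp only [map, bdry_cons, h1, hs, ih]

end strict

section linear

variable (o : Q.Ob → Q'.Ob) (g : ∀ x y : Q.Ob, Q.Hom x y →ₗ[R] Q'.Hom (o x) (o y))

theorem linMap_of_two_le {x y : Q.Ob} {c : Chain Q x y} (h : 2 ≤ c.length) :
    FormalMorphism.linMap o g c = 0 := by
  rcases c with _ | ⟨f, _ | ⟨f', c⟩⟩
  · rfl
  · simp [length] at h
  · rfl

/-- A strict morphism kills every block of length at least two, so only the subdivision into single
arrows survives. -/
theorem pull_linMap {M : Type*} [AddCommGroup M] [Module R M] {x z : Q.Ob} (c : Chain Q x z) :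
    ∀ {φ : Chain Q' (o x) (o z) → M}, IsMultilinear φ →
    pull o (FormalMorphism.linMap o g) φ c = φ (c.map o fun x y => g x y) := by
  induction c with
  | nil => intro φ _; exact pull_nil ..
  | cons f c ih =>
    intro φ h
    rw [pull_cons]
    cases c with
    | nil => simp only [cutSum_nil, pull_nil, FormalMorphism.linMap, map]
    | cons f' c =>
      rw [cutSum_cons]
      simp only [FormalMorphism.linMap, h.pull_head_zero, cutSum_zero, add_zero]
      exact ih (h.cons _)

theorem cutSum_linMap {x y z : Q.Ob} (c : Chain Q y z) :
    ∀ k : ∀ b, Chain Q y b → Q.Hom x b,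
    cutSum (fun _ l r => FormalMorphism.linMap o g (cons (k _ l) r)) c = g _ _ (k _ c) := by
  induction c with
  | nil => intro k; simp only [cutSum_nil, FormalMorphism.linMap]
  | cons f' c ih =>
    intro k
    rw [cutSum_cons, ih fun b l => k b (cons f' l)]
    simp only [FormalMorphism.linMap, zero_add]

theorem cutSum_pull_linMap {P : GQuiver.{w, u'', v''} R} (o' : P.Ob → Q.Ob)
    (F : ∀ {x y : P.Ob}, Chain P x y → Q.Hom (o' x) (o' y)) {x y z : P.Ob} (c : Chain P y z) :
    ∀ k : ∀ b, Chain P y b → Q.Hom (o' x) (o' b),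
    cutSum (fun _ l r => pull o' F (fun t => FormalMorphism.linMap o g (cons (k _ l) t)) r) c =
      g _ _ (k _ c) := by
  induction c with
  | nil => intro k; simp only [cutSum_nil, pull_nil, FormalMorphism.linMap]
  | cons f' c ih =>
    intro k
    rw [cutSum_cons, ih fun b l => k b (cons f' l), pull_cons]
    simp only [FormalMorphism.linMap, pull_zero, cutSum_zero, zero_add]

/-- The function vanishes on chains of length other than one, so only the subdivision into a single
block counts. -/
theorem _root_.AInfinity.FormalMorphism.pull_apply_linMap {P : GQuiver.{w, u'', v''} R}
    (F : FormalMorphism P Q) {x z : P.Ob} (c : Chain P x z) :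
    pull F.obj F.map (fun t => FormalMorphism.linMap o g t) c = g _ _ (F.map c) := by
  cases c with
  | nil => simp [pull_nil, F.map_nil, FormalMorphism.linMap]
  | cons f c =>
    rw [pull_cons]
    exact cutSum_pull_linMap o g F.obj F.map c fun b l => F.map (cons f l)

theorem bdry_apply_linMap (m : ∀ {x y : Q.Ob}, Chain Q x y → Q.Hom x y) {x z : Q.Ob}
    (c : Chain Q x z) : bdry m (fun t => FormalMorphism.linMap o g t) c = g _ _ (m c) := by
  cases c with
  | nil => simp only [bdry_nil, FormalMorphism.linMap]
  | cons f c =>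
    rw [bdry_cons, cutSum_linMap o g (cons f c) fun _ l => m l, bdry_congr m c (φ' := fun _ => 0),
      bdry_zero, add_zero]
    intro t ht
    exact linMap_of_two_le o g (by simp only [length]; omega)

end linear

/-! ### Multilinearity and degrees of pulled-back functions. -/

section multilinear

variable {M : Type*} [AddCommGroup M] [Module R M]

theorem cutSum_smul {x z : Q.Ob} (r : R) (ψ : ∀ y : Q.Ob, Chain Q x y → Chain Q y z → M)
    (c : Chain Q x z) : cutSum (fun y l t => r • ψ y l t) c = r • cutSum ψ c :=
  (map_cutSum (DistribSMul.toAddMonoidHom M r) ψ c).symm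

/-- Wherever the cut falls, the varied arrow lies either inside the block fed to `k` or in the
remainder, and the expression is linear in it in both cases. A general `k` lets the induction absorb
the leading arrows. -/
theorem IsMultilinear.cutSum_head {a z b e : Q.Ob} (q : Chain Q e z) (r : R) (f g : Q.Hom b e)
    {φ : Chain Q a z → M} (h : IsMultilinear φ) {x : Q.Ob} (p : Chain Q x b) :
    ∀ k : ∀ y, Chain Q x y → Q.Hom a y, (∀ y, IsMultilinear (k y)) →
    cutSum (fun _ u v => φ (Chain.cons (k _ u) v)) (p.append (Chain.cons (r • f + g) q)) =
      r • cutSum (fun _ u v => φ (Chain.cons (k _ u) v)) (p.append (Chain.cons f q)) +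
      cutSum (fun _ u v => φ (Chain.cons (k _ u) v)) (p.append (Chain.cons g q)) := by
  induction p with
  | nil =>
    intro k hk
    have h1 := (h.cons (k _ .nil)) _ _ .nil q r f g
    have h2 := fun y (l : Chain Q e y) => hk y _ _ .nil l r f g
    simp only [append] at h1 h2 ⊢
    simp only [cutSum_cons, h1, h2, h.head_add, h.head_smul, cutSum_add, cutSum_smul, smul_add]
    abel
  | cons f' p ih =>
    intro k hk
    have h1 := (h.cons (k _ .nil)) _ _ (.cons f' p) q r f g
    have h2 := ih f g (fun y l => k y (.cons f' l)) fun y => (hk y).cons f'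
    simp only [append] at h1 h2 ⊢
    simp only [cutSum_cons, h1, h2, smul_add]
    abel

theorem IsMultilinear.bdry {m : ∀ {x y : Q.Ob}, Chain Q x y → Q.Hom x y}
    (hm : ∀ x y : Q.Ob, IsMultilinear (fun c : Chain Q x y => m c)) {x z : Q.Ob}
    {φ : Chain Q x z → M} (h : IsMultilinear φ) : IsMultilinear fun c => Chain.bdry m φ c := by
  intro a b p q r f g
  have h1 := h.cutSum_head q r f g p (fun _ l => m l) (hm x)
  induction p with
  | nil =>
    simp only [append] at h1 ⊢
    simp only [bdry_cons, h1, map_add, map_smul, h.head_add, h.head_smul, bdry_add, smul_add]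
    have := map_bdry m (DistribSMul.toAddMonoidHom M r)
      (fun t => φ (Chain.cons (Q.sgn _ _ f) t)) q
    simp only [DistribSMul.toAddMonoidHom_apply] at this
    rw [this]
    abel
  | cons f' p ih =>
    have h2 := ih (h.cons (Q.sgn _ _ f')) f g
      ((h.cons (Q.sgn _ _ f')).cutSum_head q r f g p (fun _ l => m l) (hm _))
    simp only [append] at h1 ⊢
    simp only [bdry_cons, h1, h2, smul_add]
    abel

end multilinear

theorem IsHomogeneous.of_mem_cuts {x z : Q.Ob} {c : Chain Q x z} {e : ℤ} (hc : c.IsHomogeneous e) :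
    ∀ s ∈ c.cuts, ∃ d d' : ℤ, s.left.IsHomogeneous d ∧ s.right.IsHomogeneous d' ∧ d + d' = e ∧
      s.left.length + s.right.length = c.length := by
  induction hc with
  | nil =>
    intro s hs
    simp only [cuts, List.mem_singleton] at hs
    subst hs
    exact ⟨0, 0, .nil, .nil, rfl, rfl⟩
  | @cons x y z f c d e hf hc ih =>
    intro s hs
    simp only [cuts, List.mem_cons, List.mem_map] at hs
    rcases hs with rfl | ⟨s, hs, rfl⟩
    · exact ⟨0, d + e, .nil, .cons hf hc, zero_add _, by simp [length]⟩
    · obtain ⟨d1, d2, h1, h2, h3, h4⟩ := ih s hs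
      exact ⟨d + d1, d2, .cons hf h1, h2, by rw [add_assoc, h3], by simp only [length]; omega⟩

theorem IsHomogeneous.signed {x z : Q.Ob} {c : Chain Q x z} {e : ℤ} (hc : c.IsHomogeneous e) :
    c.signed.IsHomogeneous e := by
  refine IsHomogeneous.map (Q' := Q) _ _ (fun x y d f hf => ?_) hc
  rw [Q.sgn_of_mem hf]
  exact zsmul_mem hf _

theorem length_signed {x z : Q.Ob} (c : Chain Q x z) : c.signed.length = c.length :=
  length_map ..

end Chain

theorem AInfStructure.barD_homogeneous {Q : GQuiver.{w, u, v} R} (D : AInfStructure Q) {x z : Q.Ob}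
    {c : Chain Q x z} {e : ℤ} (hc : c.IsHomogeneous e) :
    ∀ t ∈ barD D.m c, t.IsHomogeneous (e + 1 - c.length + t.length) := by
  intro t ht
  simp only [barD, List.mem_flatMap, List.mem_map] at ht
  obtain ⟨s, hs, s', hs', rfl⟩ := ht
  obtain ⟨d1, d2, h1, h2, h3, h4⟩ := hc.of_mem_cuts s hs
  obtain ⟨d3, d4, h5, h6, h7, h8⟩ := h2.of_mem_cuts s' hs'
  have := h1.signed.append (.cons (D.m_mem _ _ h5) h6)
  convert this using 1
  rw [length_append, length_signed, length, ← h3, ← h7, ← h4, ← h8]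
  push_cast
  ring

theorem isAInfFunctor_iff {Q : GQuiver.{w, u, v} R} {Q' : GQuiver.{w, u', v'} R}
    {D : AInfStructure Q} {D' : AInfStructure Q'} {F : FormalMorphism Q Q'} :
    IsAInfFunctor D D' F ↔ ∀ {x y : Q.Ob} (c : Chain Q x y),
      bdry D.m (fun t => F.map t) c = pull F.obj F.map (fun t => D'.m t) c := Iff.rfl

theorem isAInfFunctor_ofLinear {Q : GQuiver.{w, u, v} R} {Q' : GQuiver.{w, u', v'} R}
    {D : AInfStructure Q} {D' : AInfStructure Q'} {o : Q.Ob → Q'.Ob}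
    {g : ∀ x y : Q.Ob, Q.Hom x y →ₗ[R] Q'.Hom (o x) (o y)}
    {hg : ∀ x y d f, f ∈ Q.gr x y d → g x y f ∈ Q'.gr (o x) (o y) d} :
    IsAInfFunctor D D' (.ofLinear o g hg) ↔ ∀ {x y : Q.Ob} (c : Chain Q x y),
      g x y (D.m c) = D'.m (c.map o fun x y => g x y) := by
  have h1 : ∀ {x y : Q.Ob} (c : Chain Q x y), bdry D.m
      (fun t => (FormalMorphism.ofLinear o g hg).map t) c = g x y (D.m c) :=
    fun c => bdry_apply_linMap o g D.m c
  have h2 : ∀ {x y : Q.Ob} (c : Chain Q x y), pull (FormalMorphism.ofLinear o g hg).obj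
      (FormalMorphism.ofLinear o g hg).map (fun t => D'.m t) c =
      D'.m (c.map o fun x y => g x y) :=
    fun c => pull_linMap o g c (D'.multilinear _ _)
  simp only [isAInfFunctor_iff, h1, h2]
  exact Iff.rfl

/-- The Koszul rule for formal morphisms, read on a chain with one arrow. -/
theorem sgn_graded {Q : GQuiver.{w, u, v} R} {Q' : GQuiver.{w, u', v'} R} {o : Q.Ob → Q'.Ob}
    {g : ∀ x y : Q.Ob, Q.Hom x y →ₗ[R] Q'.Hom (o x) (o y)}
    (hg : ∀ x y d f, f ∈ Q.gr x y d → g x y f ∈ Q'.gr (o x) (o y) d) (x y : Q.Ob) (f : Q.Hom x y) :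
    Q'.sgn _ _ (g x y f) = g x y (Q.sgn x y f) :=
  ((FormalMorphism.ofLinear o g hg).map_signed (cons f nil)).symm

theorem FormalMorphism.pull_mem {Q : GQuiver.{w, u, v} R} {Q' : GQuiver.{w, u', v'} R}
    {Q'' : GQuiver.{w, u'', v''} R} (F : FormalMorphism Q Q') {x z : Q.Ob} {a b : Q''.Ob}
    {φ : Chain Q' (F.obj x) (F.obj z) → Q''.Hom a b} (k : ℤ)
    (h : ∀ c e, c.IsHomogeneous e → φ c ∈ Q''.gr a b (e + k - c.length)) {c : Chain Q x z} {e : ℤ}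
    (hc : c.IsHomogeneous e) : pull F.obj F.map φ c ∈ Q''.gr a b (e + k - c.length) := by
  apply list_sum_mem
  intro g hg
  obtain ⟨t, ht, rfl⟩ := List.mem_map.1 hg
  convert h t _ (F.barF_homogeneous hc t ht) using 2
  ring

theorem AInfStructure.bdry_mem {Q : GQuiver.{w, u, v} R} {Q'' : GQuiver.{w, u'', v''} R}
    (D : AInfStructure Q) {x z : Q.Ob} {a b : Q''.Ob} {φ : Chain Q x z → Q''.Hom a b} (k : ℤ)
    (h : ∀ c e, c.IsHomogeneous e → φ c ∈ Q''.gr a b (e + k - c.length)) {c : Chain Q x z} {e : ℤ}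
    (hc : c.IsHomogeneous e) : bdry D.m φ c ∈ Q''.gr a b (e + (k + 1) - c.length) := by
  apply list_sum_mem
  intro g hg
  obtain ⟨t, ht, rfl⟩ := List.mem_map.1 hg
  convert h t _ (D.barD_homogeneous hc t ht) using 2
  ring

/-! ### Inverting unipotent formal endomorphisms and conjugating A∞-structures by them. -/

namespace Chain

variable {Q : GQuiver.{w, u, v} R} {Q' : GQuiver.{w, u', v'} R}

theorem pull_congr_of_length_le {M : Type*} [AddCommMonoid M] (o : Q.Ob → Q'.Ob)
    (F F' : ∀ {x y : Q.Ob}, Chain Q x y → Q'.Hom (o x) (o y)) {x z : Q.Ob}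
    (φ : Chain Q' (o x) (o z) → M) (c : Chain Q x z)
    (h : ∀ {x y : Q.Ob} (t : Chain Q x y), t.length ≤ c.length → F t = F' t) :
    pull o F φ c = pull o F' φ c := by
  induction hn : c.length using Nat.strong_induction_on generalizing x with
  | _ n ih =>
  cases c with
  | nil => simp only [pull_nil]
  | cons f c =>
    rw [pull_cons, pull_cons]
    refine cutSum_congr c fun y l r hlr => ?_
    simp only [length] at hn h
    rw [h (cons f l) (by simp only [length]; omega)]
    exact ih r.length (by omega) _ r (fun t ht => h t (by omega)) rfl

/-- The one subdivision that evaluates `F` on the whole chain is a single block, where `φ` vanishes.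
This makes the fixed-point equation for the inverse recursive in the length. -/
theorem pull_congr_of_length_lt {M : Type*} [AddCommMonoid M] (o : Q.Ob → Q'.Ob)
    (F F' : ∀ {x y : Q.Ob}, Chain Q x y → Q'.Hom (o x) (o y)) {x z : Q.Ob}
    (φ : Chain Q' (o x) (o z) → M) (hφ : ∀ f, φ (cons f nil) = 0) (c : Chain Q x z)
    (h : ∀ {x y : Q.Ob} (t : Chain Q x y), t.length < c.length → F t = F' t) :
    pull o F φ c = pull o F' φ c := by
  cases c with
  | nil => simp only [pull_nil]
  | cons f c =>
    rw [pull_cons, pull_cons]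
    refine cutSum_congr c fun y l r hlr => ?_
    cases r with
    | nil => simp only [pull_nil, hφ]
    | cons f' r =>
      simp only [length] at h hlr
      rw [h (cons f l) (by simp only [length]; omega)]
      exact pull_congr_of_length_le o F F' _ _ fun t ht => h t (by simp only [length] at ht; omega)

/-- The identity on chains of length one, zero on other chains. -/
def linPart {x y : Q.Ob} (c : Chain Q x y) : Q.Hom x y :=
  FormalMorphism.linMap (Q' := Q) (fun x => x) (fun _ _ => LinearMap.id) c

/-- The components of a formal endomorphism whose part of length one is the identity. -/
structure IsUnipotent (P : ∀ {x y : Q.Ob}, Chain Q x y → Q.Hom x y) : Prop where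
  map_nil : ∀ x : Q.Ob, P (Chain.nil : Chain Q x x) = 0
  single : ∀ {x y : Q.Ob} (f : Q.Hom x y), P (Chain.cons f .nil) = f
  multilinear : ∀ x y : Q.Ob, IsMultilinear (fun c : Chain Q x y => P c)
  map_mem : ∀ {x y : Q.Ob} (c : Chain Q x y) (e : ℤ), c.IsHomogeneous e →
    P c ∈ Q.gr x y (e + 1 - c.length)

variable {P P' : ∀ {x y : Q.Ob}, Chain Q x y → Q.Hom x y}

/-- The formal endomorphism with given unipotent components. -/
def IsUnipotent.toFormal (hP : IsUnipotent P) : FormalMorphism Q Q where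
  obj x := x
  map c := P c
  map_nil := hP.map_nil
  multilinear := hP.multilinear
  map_mem := hP.map_mem

theorem isUnipotent_linPart : IsUnipotent (fun {x y} (c : Chain Q x y) => linPart c) where
  map_nil _ := rfl
  single _ := rfl
  multilinear x y := FormalMorphism.linMap_multilinear (Q' := Q) (fun x => x) _ x y
  map_mem c e hc := FormalMorphism.linMap_mem (Q' := Q) (fun x => x) _ (fun _ _ _ _ h => h) c e hc

theorem pull_linPart {M : Type*} [AddCommGroup M] [Module R M] {x z : Q.Ob} (c : Chain Q x z)
    {φ : Chain Q x z → M} (h : IsMultilinear φ) :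
    pull (Q' := Q) (fun x => x) (fun c => linPart c) φ c = φ c :=
  (pull_linMap (Q' := Q) (fun x => x) (fun _ _ => LinearMap.id) c h).trans
    (congrArg φ (map_id c))

theorem IsUnipotent.pull_apply_linPart (hP : IsUnipotent P) {x z : Q.Ob} (c : Chain Q x z) :
    pull (Q' := Q) (fun x => x) P (fun t => linPart t) c = P c :=
  hP.toFormal.pull_apply_linMap (Q' := Q) (fun x => x) (fun _ _ => LinearMap.id) c

theorem IsUnipotent.pull_multilinear (hP : IsUnipotent P) {M : Type*} [AddCommGroup M] [Module R M]
    {x z : Q.Ob} {φ : Chain Q x z → M} (h : IsMultilinear φ) :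
    IsMultilinear (fun c => pull (Q' := Q) (fun x => x) P φ c) :=
  hP.toFormal.pull_multilinear h

variable (P) in
/-- Successive approximations of the inverse of a unipotent formal endomorphism. -/
def invApprox : ℕ → ∀ {x y : Q.Ob}, Chain Q x y → Q.Hom x y
  | 0, _, _, c => linPart c
  | n + 1, _, _, c =>
    linPart c - pull (Q' := Q) (fun x => x) (fun c => invApprox n c) (fun t => P t - linPart t) c

theorem IsUnipotent.invApprox (hP : IsUnipotent P) (n : ℕ) :
    IsUnipotent (fun {x y} (c : Chain Q x y) => invApprox P n c) := by
  induction n with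
  | zero => exact isUnipotent_linPart
  | succ n ih =>
    refine ⟨fun x => ?_, fun f => ?_, fun x y => ?_, fun {x y} c e hc => ?_⟩
    · simp only [Chain.invApprox, pull_nil, hP.map_nil]
      simp [linPart, FormalMorphism.linMap]
    · simp only [Chain.invApprox, pull_cons, cutSum_nil, pull_nil, hP.single]
      simp [linPart, FormalMorphism.linMap]
    · exact (isUnipotent_linPart.multilinear x y).sub
        (ih.pull_multilinear ((hP.multilinear x y).sub (isUnipotent_linPart.multilinear x y)))
    · exact sub_mem (isUnipotent_linPart.map_mem c e hc) (ih.toFormal.pull_mem 1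
        (fun c e hc => sub_mem (hP.map_mem c e hc) (isUnipotent_linPart.map_mem c e hc)) hc)

theorem IsUnipotent.sub_linPart_single (hP : IsUnipotent P) {x y : Q.Ob} (f : Q.Hom x y) :
    P (Chain.cons f .nil) - linPart (Chain.cons f .nil) = 0 := by
  rw [hP.single, sub_eq_zero]
  rfl

/-- The correction `P - linPart` vanishes on single arrows, so the value of each approximation on a
chain depends only on the previous one on strictly shorter chains. Each step thus settles one more
length. -/
theorem IsUnipotent.invApprox_succ (hP : IsUnipotent P) (n : ℕ) :
    ∀ {x y : Q.Ob} (c : Chain Q x y), c.length ≤ n + 1 →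
      Chain.invApprox P (n + 1) c = Chain.invApprox P n c := by
  induction n with
  | zero =>
    intro x y c hc
    rw [Chain.invApprox, Chain.invApprox, sub_eq_self]
    rw [pull_congr_of_length_lt (Q' := Q) (fun x => x) _ (fun _ => 0) _ hP.sub_linPart_single]
    · rcases c with _ | ⟨f, _ | ⟨f', c⟩⟩
      · simp only [pull_nil, hP.map_nil]
        simp [linPart, FormalMorphism.linMap]
      · simp only [pull_cons, cutSum_nil, pull_nil]
        exact hP.sub_linPart_single _
      · simp [length] at hc
    · intro x y t ht
      rcases t with _ | ⟨f, t⟩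
      · rfl
      · simp only [length] at ht; omega
  | succ n ih =>
    intro x y c hc
    rw [Chain.invApprox, Chain.invApprox]
    congr 1
    exact pull_congr_of_length_lt (Q' := Q) (fun x => x) _ _ _ hP.sub_linPart_single _
      fun t ht => ih t (by omega)

theorem IsUnipotent.invApprox_of_le (hP : IsUnipotent P) {n k : ℕ} {x y : Q.Ob} (c : Chain Q x y)
    (hc : c.length ≤ n) (hk : n ≤ k) : Chain.invApprox P k c = Chain.invApprox P n c := by
  induction k, hk using Nat.le_induction with
  | base => rfl
  | succ k hk ih => rw [hP.invApprox_succ k c (by omega), ih]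

theorem IsUnipotent.exists_right_inverse (hP : IsUnipotent P) :
    ∃ P' : ∀ {x y : Q.Ob}, Chain Q x y → Q.Hom x y, IsUnipotent P' ∧
      ∀ {x y : Q.Ob} (c : Chain Q x y),
        pull (Q' := Q) (fun x => x) P' (fun t => P t) c = linPart c := by
  -- The limit is taken diagonally: the approximation used is the one indexed by the length of the
  -- chain. Varying one arrow keeps the length, so multilinearity is that of a single approximation.
  have hU : IsUnipotent (fun {x y} (c : Chain Q x y) => Chain.invApprox P c.length c) := by
    refine ⟨fun x => (hP.invApprox 0).map_nil x, fun f => (hP.invApprox 1).single f,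
      fun x y => ?_, fun c e hc => (hP.invApprox _).map_mem c e hc⟩
    intro a b p q r f g
    have := (hP.invApprox (p.append (.cons f q)).length).multilinear x y a b p q r f g
    simpa only [length_append, length] using this
  refine ⟨fun c => Chain.invApprox P c.length c, hU, fun {x y} c => ?_⟩
  have h1 : Chain.invApprox P c.length c =
      linPart c - pull (Q' := Q) (fun x => x) (fun c => Chain.invApprox P c.length c)
        (fun t => P t - linPart t) c := by
    rw [← hP.invApprox_succ c.length c (by omega), Chain.invApprox]
    congr 1
    exact pull_congr_of_length_lt (Q' := Q) (fun x => x) _ _ _ hP.sub_linPart_single _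
      fun t ht => hP.invApprox_of_le t le_rfl (by omega)
  have h2 := pull_add (Q' := Q) (fun x => x) (fun c => Chain.invApprox P c.length c)
    (fun t => P t - linPart t) (fun t => linPart t) c
  simp only [sub_add_cancel] at h2
  rw [h2, hU.pull_apply_linPart]
  conv_lhs => rw [h1]
  abel

theorem IsUnipotent.pull_pull (hP : IsUnipotent P) (hP' : IsUnipotent P')
    (h : ∀ {x y : Q.Ob} (c : Chain Q x y),
      pull (Q' := Q) (fun x => x) P' (fun t => P t) c = linPart c)
    {M : Type*} [AddCommGroup M] [Module R M] {x z : Q.Ob} {φ : Chain Q x z → M}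
    (hφ : IsMultilinear φ) (c : Chain Q x z) :
    pull (Q' := Q) (fun x => x) P' (fun t => pull (Q' := Q) (fun x => x) P φ t) c = φ c := by
  have := FormalMorphism.pull_comp hP.toFormal hP'.toFormal hφ c
  refine this.symm.trans ?_
  have h' : (fun {x y : Q.Ob} (c : Chain Q x y) =>
    pull (Q' := Q) (fun x => x) P' (fun t => P t) c) = fun {x y} c => linPart c := by
    funext x y c; exact h c
  refine Eq.trans ?_ (pull_linPart c hφ)
  exact congrArg (fun F : ∀ x y : Q.Ob, Chain Q x y → Q.Hom x y =>
    pull (Q' := Q) (fun x => x) (fun {x y} c => F x y c) φ c) h'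

theorem IsUnipotent.exists_inverse (hP : IsUnipotent P) :
    ∃ P' : ∀ {x y : Q.Ob}, Chain Q x y → Q.Hom x y, IsUnipotent P' ∧
      (∀ {x y : Q.Ob} (c : Chain Q x y),
        pull (Q' := Q) (fun x => x) P' (fun t => P t) c = linPart c) ∧
      ∀ {x y : Q.Ob} (c : Chain Q x y),
        pull (Q' := Q) (fun x => x) P (fun t => P' t) c = linPart c := by
  obtain ⟨P', hP', h⟩ := hP.exists_right_inverse
  obtain ⟨P'', hP'', h'⟩ := hP'.exists_right_inverse
  refine ⟨P', hP', h, fun {x y} c => ?_⟩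
  -- Pulling back along `P'` is injective on multilinear functions, since `P'` has a right inverse
  -- `P''`. The two sides agree after this pullback: both become `P'`.
  have h1 := hP'.pull_pull hP'' h' (hP.pull_multilinear (hP'.multilinear x y)) c
  have h2 := hP'.pull_pull hP'' h' (isUnipotent_linPart.multilinear x y) c
  rw [← h1, ← h2]
  congr 1
  funext t
  rw [hP.pull_pull hP' h (hP'.multilinear x y), hP'.pull_apply_linPart]

theorem IsUnipotent.pull_injective (hP : IsUnipotent P) {M : Type*} [AddCommGroup M] [Module R M]
    {x z : Q.Ob} {φ ψ : Chain Q x z → M} (hφ : IsMultilinear φ) (hψ : IsMultilinear ψ)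
    (h : ∀ c, pull (Q' := Q) (fun x => x) P φ c = pull (Q' := Q) (fun x => x) P ψ c)
    (c : Chain Q x z) : φ c = ψ c := by
  obtain ⟨P', hP', h1, -⟩ := hP.exists_inverse
  rw [← hP.pull_pull hP' h1 hφ c, ← hP.pull_pull hP' h1 hψ c]
  congr 1
  funext t
  exact h t

/-- Transport of an A∞-structure along a unipotent formal automorphism. -/
theorem IsUnipotent.exists_transport (hP : IsUnipotent P) (D : AInfStructure Q) :
    ∃ E : AInfStructure Q, IsAInfFunctor D E hP.toFormal := by
  obtain ⟨P', hP', h1, h2⟩ := hP.exists_inverse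
  have hb : ∀ x y : Q.Ob, IsMultilinear fun c : Chain Q x y => bdry D.m (fun t => P t) c :=
    fun x y => (hP.multilinear x y).bdry D.multilinear
  let m : ∀ {x y : Q.Ob}, Chain Q x y → Q.Hom x y := fun c =>
    pull (Q' := Q) (fun x => x) P' (fun t => bdry D.m (fun t => P t) t) c
  have hm : ∀ x y : Q.Ob, IsMultilinear fun c : Chain Q x y => m c :=
    fun x y => hP'.pull_multilinear (hb x y)
  have hF : ∀ {x y : Q.Ob} (c : Chain Q x y), bdry D.m (fun t => P t) c =
      pull (Q' := Q) (fun x => x) P (fun t => m t) c := fun {x y} c =>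
    (hP'.pull_pull hP h2 (hb x y) c).symm
  refine ⟨⟨m, hm, fun {x y} c e hc => ?_, fun {x y} c => ?_⟩, hF⟩
  · exact hP'.toFormal.pull_mem 2 (fun c e hc => D.bdry_mem 1 hP.map_mem hc) hc
  -- It is enough to check the relation after pulling back along `P`. There it becomes the square of
  -- the original differential, because `bdry_pull` does not require the new operations to satisfy
  -- any relation yet.
  · refine hP.pull_injective (φ := fun c => bdry m (fun t => m t) c) (ψ := fun _ => 0)
      ((hm x y).bdry hm) (fun a b p q r f g => by simp) (fun c => ?_) c
    rw [pull_zero]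
    refine (hP.toFormal.bdry_pull D.m m hF (hm x y) c).symm.trans ?_
    refine Eq.trans ?_ (D.bdry_bdry (hP.multilinear x y) c)
    congr 1
    funext t
    exact (hF t).symm

end Chain

/-! ### The structure on $(K\times A')_S$ and its projection. -/

section transport

variable {A : GQuiver.{w, u, v} R} {A' : GQuiver.{w, u', v'} R} {A'' : GQuiver.{w, u'', v''} R}

theorem isAInfFunctor_sndMor {Q : GQuiver.{w, u, v} R} {Q' : GQuiver.{w, u', v'} R}
    {S : Q.Ob × Q'.Ob → Prop} {D : AInfStructure (subProd Q Q' S)} {D' : AInfStructure Q'} :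
    IsAInfFunctor D D' (sndMor Q Q' S) ↔ ∀ {p q : (subProd Q Q' S).Ob}
      (c : Chain (subProd Q Q' S) p q), (D.m c).2 = D'.m (sndChain c) :=
  isAInfFunctor_ofLinear (Q := subProd Q Q' S) (o := fun p => p.1.2)
    (g := fun _ _ => LinearMap.snd R _ _) (hg := fun _ _ _ _ hf => hf.2)

namespace Splitting

variable {F : FormalMorphism A A'} (σ : Splitting F)

theorem isUnipotent_Phi : IsUnipotent (fun {x y} (c : Chain A x y) => σ.Phi.map c) :=
  ⟨σ.Phi.map_nil, σ.Phi_one, σ.Phi.multilinear, σ.Phi.map_mem⟩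

variable (F) in
/-- The bijection `a ↦ (a, F⁰ a)` of the objects of `A` and of `(K × A')_S`. -/
abbrev isoOb (a : A.Ob) : (KA' F).Ob := ⟨(a, F.obj a), rfl⟩

/-- The inverse of `isoOb`. -/
abbrev fstOb (p : (KA' F).Ob) : A.Ob := p.1.1

theorem exists_ob_eq (p : (KA' F).Ob) : ∃ a : A.Ob, p = isoOb F a := by
  obtain ⟨⟨a, b⟩, h⟩ := p
  obtain rfl : b = F.obj a := h
  exact ⟨a, rfl⟩

/-- The isomorphisms `f ↦ (r¹ f, F¹ f)`, with the objects of `A'` known up to equality. -/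
def fwdOfEq (a b : A.Ob) : ∀ a' b' : A'.Ob, a' = F.obj a → b' = F.obj b →
    (A.Hom a b →ₗ[R] LinearMap.ker (F.lin a b) × A'.Hom a' b')
  | _, _, rfl, rfl => (σ.r a b).prod (F.lin a b)

/-- The isomorphisms `(k, a') ↦ k + s¹ a'`, with the objects of `A'` known up to equality. -/
def invOfEq (a b : A.Ob) : ∀ a' b' : A'.Ob, a' = F.obj a → b' = F.obj b →
    (LinearMap.ker (F.lin a b) × A'.Hom a' b' →ₗ[R] A.Hom a b)
  | _, _, rfl, rfl => (LinearMap.ker (F.lin a b)).subtype.coprod (σ.s a b)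

/-- The isomorphisms `f ↦ (r¹ f, F¹ f)`, for arbitrary objects of `(K × A')_S`. -/
def fwd (p q : (KA' F).Ob) : A.Hom (fstOb p) (fstOb q) →ₗ[R] (KA' F).Hom p q :=
  σ.fwdOfEq p.1.1 q.1.1 p.1.2 q.1.2 p.2 q.2

/-- The isomorphisms `(k, a') ↦ k + s¹ a'`, for arbitrary objects of `(K × A')_S`. -/
def inv (p q : (KA' F).Ob) : (KA' F).Hom p q →ₗ[R] A.Hom (fstOb p) (fstOb q) :=
  σ.invOfEq p.1.1 q.1.1 p.1.2 q.1.2 p.2 q.2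

theorem fwd_mem (p q : (KA' F).Ob) (d : ℤ) (f : A.Hom (fstOb p) (fstOb q))
    (hf : f ∈ A.gr (fstOb p) (fstOb q) d) : σ.fwd p q f ∈ (KA' F).gr p q d := by
  obtain ⟨a, rfl⟩ := exists_ob_eq p
  obtain ⟨b, rfl⟩ := exists_ob_eq q
  exact ⟨Submodule.sub_mem _ hf (σ.s_mem _ _ _ _ (F.lin_mem hf)), F.lin_mem hf⟩

theorem inv_mem (p q : (KA' F).Ob) (d : ℤ) (f : (KA' F).Hom p q)
    (hf : f ∈ (KA' F).gr p q d) : σ.inv p q f ∈ A.gr (fstOb p) (fstOb q) d := by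
  obtain ⟨a, rfl⟩ := exists_ob_eq p
  obtain ⟨b, rfl⟩ := exists_ob_eq q
  have h2 := σ.s_mem a b d f.2 hf.2
  have h1 : (f.1 : A.Hom a b) ∈ A.gr a b d := hf.1
  simpa [inv, invOfEq] using Submodule.add_mem _ h1 h2

theorem inv_fwd (a b : A.Ob) (f : A.Hom a b) :
    σ.inv (isoOb F a) (isoOb F b) (σ.fwd (isoOb F a) (isoOb F b) f) =
      f := by
  simp [inv, fwd, invOfEq, fwdOfEq, r]

theorem fwd_inv (p q : (KA' F).Ob) (f : (KA' F).Hom p q) : σ.fwd p q (σ.inv p q f) = f := by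
  obtain ⟨a, rfl⟩ := exists_ob_eq p
  obtain ⟨b, rfl⟩ := exists_ob_eq q
  obtain ⟨k, f⟩ := f
  have hk : F.lin a b k = 0 := k.2
  refine Prod.ext (Subtype.ext ?_) ?_
  · simp [inv, fwd, invOfEq, fwdOfEq, r, hk, σ.lin_s]
  · simp [inv, fwd, invOfEq, fwdOfEq, hk, σ.lin_s]

/-- The isomorphism `A ≃ (K × A')_S` on chains. -/
def isoChain {x y : A.Ob} (c : Chain A x y) : Chain (KA' F) (σ.iso.obj x) (σ.iso.obj y) :=
  c.map (Q := A) (Q' := KA' F) (isoOb F) fun x y => σ.fwd (isoOb F x) (isoOb F y)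

/-- The inverse isomorphism on chains. -/
def invChain {p q : (KA' F).Ob} (c : Chain (KA' F) p q) : Chain A (fstOb p) (fstOb q) :=
  c.map (Q := KA' F) (Q' := A) fstOb fun p q => σ.inv p q

theorem invChain_isoChain : ∀ {x y : A.Ob} (c : Chain A x y), σ.invChain (σ.isoChain c) = c
  | _, _, .nil => rfl
  | _, _, .cons f c => congrArg₂ Chain.cons (σ.inv_fwd _ _ f) (invChain_isoChain c)

/-- An object of $(K\times A')_S$ has the form `isoOb F a` only up to a propositional equality. An
induction principle with a motive in the endpoints avoids casts between types of arrows. -/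
theorem isoChain_surjective {p q : (KA' F).Ob} (c : Chain (KA' F) p q) :
    ∀ motive : ∀ p q : (KA' F).Ob, Chain (KA' F) p q → Prop,
    (∀ (x y : A.Ob) (c : Chain A x y), motive _ _ (σ.isoChain c)) → motive p q c := by
  induction c with
  | @nil p =>
    intro motive h
    obtain ⟨a, rfl⟩ := exists_ob_eq p
    exact h a a .nil
  | @cons p q t f c ih =>
    intro motive h
    refine ih (fun q t c => ∀ f : (KA' F).Hom p q, motive p t (.cons f c)) (fun x y c f => ?_) f
    obtain ⟨a, rfl⟩ := exists_ob_eq p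
    rw [← σ.fwd_inv _ _ f]
    exact h a y (.cons (σ.inv (isoOb F a) (isoOb F x) f) c)

/-- Transport of an A∞-structure along the isomorphism of graded quivers `A ≃ (K × A')_S`. -/
def transport (E : AInfStructure A) : AInfStructure (KA' F) where
  m {p q} c := σ.fwd p q (E.m (σ.invChain c))
  multilinear p q :=
    ((E.multilinear (fstOb p) (fstOb q)).comp_map (Q := KA' F) (Q' := A) fstOb
      (fun p q => σ.inv p q)).comp_linear (σ.fwd p q)
  m_mem {p q} c e hc := by
    have h1 := hc.map (Q := KA' F) (Q' := A) fstOb (fun p q => σ.inv p q) σ.inv_mem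
    have h2 := σ.fwd_mem p q _ _ (E.m_mem _ _ h1)
    rwa [length_map] at h2
  stasheff {p q} c := by
    refine σ.isoChain_surjective c (fun p q c => ((Chain.barD (fun {p q} c =>
      σ.fwd p q (E.m (σ.invChain c))) c).map fun t => σ.fwd p q (E.m (σ.invChain t))).sum = 0)
      fun x y c => ?_
    refine (bdry_map (Q := A) (Q' := KA' F) (isoOb F)
      (fun x y => σ.fwd (isoOb F x) (isoOb F y)) E.m
      (fun {p q} c => σ.fwd p q (E.m (σ.invChain c))) ?_ ?_ c _).trans ?_
    · exact sgn_graded (Q := A) (Q' := KA' F) fun x y d f hf =>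
        σ.fwd_mem (isoOb F x) (isoOb F y) d f hf
    · intro x y c
      exact congrArg (fun c => σ.fwd _ _ (E.m c)) (σ.invChain_isoChain c)
    · have h1 := fun c : Chain A x y => σ.invChain_isoChain c
      unfold isoChain at h1
      simp only [h1]
      refine (map_bdry E.m (σ.fwd (isoOb F x) (isoOb F y)).toAddMonoidHom
        (fun t => E.m t) c).symm.trans ?_
      exact (congrArg _ (E.stasheff c)).trans (map_zero _)

theorem transport_m_isoChain (E : AInfStructure A) {x y : A.Ob} (c : Chain A x y) :
    (σ.transport E).m (σ.isoChain c) = ((σ.r x y (E.m c), F.lin x y (E.m c)) :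
      (KA' F).Hom (σ.iso.obj x) (σ.iso.obj y)) :=
  congrArg (fun c => σ.fwd (σ.iso.obj x) (σ.iso.obj y) (E.m c)) (σ.invChain_isoChain c)

theorem pull_iso_comp_Phi {M : Type*} [AddCommGroup M] [Module R M] {x z : A.Ob}
    {φ : Chain (KA' F) (σ.iso.obj x) (σ.iso.obj z) → M} (h : IsMultilinear φ) (c : Chain A x z) :
    pull (σ.iso.comp σ.Phi).obj (σ.iso.comp σ.Phi).map φ c =
      pull (Q' := A) (fun x => x) σ.Phi.map (fun t => φ (σ.isoChain t)) c := by
  refine (FormalMorphism.pull_comp σ.iso σ.Phi h c).trans ?_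
  congr 1
  funext t
  exact pull_linMap (Q := A) (Q' := KA' F) (isoOb F) (fun x y => σ.fwd (isoOb F x) (isoOb F y)) t h

theorem iso_comp_Phi_map {x y : A.Ob} (c : Chain A x y) :
    (σ.iso.comp σ.Phi).map c = σ.fwd (σ.iso.obj x) (σ.iso.obj y) (σ.Phi.map c) :=
  σ.Phi.pull_apply_linMap (Q' := KA' F) (isoOb F)
    (fun x y => σ.fwd (isoOb F x) (isoOb F y)) c

theorem lin_Phi_map {x y : A.Ob} (c : Chain A x y) : F.lin x y (σ.Phi.map c) = F.map c := by
  rcases c with _ | ⟨f, _ | ⟨f', c⟩⟩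
  · rw [F.map_nil]
    exact (congrArg _ (σ.Phi.map_nil x)).trans (map_zero _)
  · rw [σ.Phi_one, F.lin_apply]
  · rw [σ.Phi_two, σ.lin_s]

theorem isoChain_multilinear {M : Type*} [AddCommGroup M] [Module R M] {x z : A.Ob}
    {φ : Chain (KA' F) (σ.iso.obj x) (σ.iso.obj z) → M} (h : IsMultilinear φ) :
    IsMultilinear fun t => φ (σ.isoChain t) :=
  h.comp_map (Q := A) (Q' := KA' F) (isoOb F)
    fun x y => σ.fwd (isoOb F x) (isoOb F y)

theorem isTransported_transport {D E : AInfStructure A} (hE : IsAInfFunctor D E σ.Phi) :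
    σ.IsTransported D (σ.transport E) := by
  have h0 : ∀ {x y : A.Ob} (c : Chain A x y),
      bdry D.m (fun t => (σ.iso.comp σ.Phi).map t) c =
        pull (σ.iso.comp σ.Phi).obj (σ.iso.comp σ.Phi).map (fun t => (σ.transport E).m t) c := by
    intro x y c
    refine Eq.trans ?_ (σ.pull_iso_comp_Phi ((σ.transport E).multilinear _ _) c).symm
    simp only [σ.iso_comp_Phi_map, σ.transport_m_isoChain]
    refine (map_bdry D.m (σ.fwd (σ.iso.obj x) (σ.iso.obj y)).toAddMonoidHom
        (fun t => σ.Phi.map t) c).symm.trans ?_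
    refine (congrArg _ (hE c)).trans ?_
    exact map_pull (Q' := A) (fun x => x) σ.Phi.map
      (σ.fwd (σ.iso.obj x) (σ.iso.obj y)).toAddMonoidHom (fun t => E.m t) c
  refine ⟨h0, fun E' hE' => ?_⟩
  have key : ∀ (x y : A.Ob) (c : Chain A x y),
      E'.m (σ.isoChain c) = (σ.transport E).m (σ.isoChain c) := by
    intro x y c
    -- Uniqueness: after pulling back along `Φ`, both structures are given by the left-hand side of
    -- the functor equation, which involves only `D`.
    refine σ.isUnipotent_Phi.pull_injective (σ.isoChain_multilinear (E'.multilinear _ _))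
      (σ.isoChain_multilinear ((σ.transport E).multilinear _ _)) (fun c => ?_) c
    refine (σ.pull_iso_comp_Phi (E'.multilinear _ _) c).symm.trans ?_
    refine Eq.trans ?_ (σ.pull_iso_comp_Phi ((σ.transport E).multilinear _ _) c)
    exact (hE' c).symm.trans (h0 c)
  ext p q c
  · exact congrArg (fun f : (KA' F).Hom p q => (f.1 : A.Hom (fstOb p) (fstOb q)))
      (σ.isoChain_surjective c (fun p q c => E'.m c = (σ.transport E).m c) key)
  · exact congrArg (fun f : (KA' F).Hom p q => f.2)
      (σ.isoChain_surjective c (fun p q c => E'.m c = (σ.transport E).m c) key)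

theorem isAInfFunctor_prA' {D E : AInfStructure A} {D' : AInfStructure A'}
    (hE : IsAInfFunctor D E σ.Phi) (hF : IsAInfFunctor D D' F) :
    IsAInfFunctor (σ.transport E) D' (prA' F) := by
  refine isAInfFunctor_sndMor.2 fun {p q} c => ?_
  refine σ.isoChain_surjective c (fun p q c => ((σ.transport E).m c).2 = D'.m (sndChain c))
    fun x y c => ?_
  rw [σ.transport_m_isoChain]
  have hsnd : ∀ {x y : A.Ob} (c : Chain A x y),
      sndChain (σ.isoChain c) = c.map F.obj fun x y => F.lin x y := by
    intro x y c
    induction c with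
    | nil => rfl
    | cons f c ih => exact congrArg (Chain.cons _) ih
  rw [hsnd]
  have hm := (D'.multilinear (F.obj x) (F.obj y)).comp_map F.obj fun x y => F.lin x y
  -- The claim is now that $F^1$ is a strict A∞-functor from `E`. It is checked after pulling back
  -- along `Φ`, where it becomes the hypothesis on `F`.
  refine σ.isUnipotent_Phi.pull_injective ((E.multilinear x y).comp_linear (F.lin x y)) hm
    (fun c => ?_) c
  refine (map_pull (Q' := A) (fun x => x) σ.Phi.map (F.lin x y).toAddMonoidHom
    (fun t => E.m t) c).symm.trans ?_
  refine (congrArg _ (hE c).symm).trans ?_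
  refine (map_bdry D.m (F.lin x y).toAddMonoidHom (fun t => σ.Phi.map t) c).trans ?_
  have h1 := hF c
  have h2 := fun c : Chain A x y => σ.lin_Phi_map c
  refine Eq.trans ?_ (h1.trans ?_)
  · congr 1
    funext t
    exact congrArg (fun g : Chain A x y → _ => g t) (funext h2)
  -- `L` is $F^1$ as a strict morphism. The composite of `Φ` and `L` is `F`, so the pullback along
  -- `F` factors accordingly.
  · let L : FormalMorphism A A' :=
      .ofLinear F.obj (fun x y => F.lin x y) fun _ _ _ _ hf => F.lin_mem hf
    have h3 := FormalMorphism.pull_comp L σ.Phi (D'.multilinear (F.obj x) (F.obj y)) c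
    have h4 : (fun {x y : A.Ob} (c : Chain A x y) =>
        pull σ.Phi.obj σ.Phi.map (fun t => L.map t) c) = fun {x y} c => F.map c := by
      funext x y c
      exact (σ.Phi.pull_apply_linMap F.obj (fun x y => F.lin x y) c).trans (σ.lin_Phi_map c)
    have h5 := congrArg (fun G : ∀ x y : A.Ob, Chain A x y → A'.Hom (F.obj x) (F.obj y) =>
      pull F.obj (fun {x y} c => G x y c) (fun t => D'.m t) c) h4
    refine (h5.symm.trans h3).trans ?_
    congr 1
    funext t
    exact pull_linMap _ _ t (D'.multilinear _ _)

end Splitting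

/-! ### The structure on $(K\times A'')_{S'}$ and the commutative square. -/

section pullback

variable {F : FormalMorphism A A'} {G : FormalMorphism A'' A'}

theorem pull_sndMor {Q : GQuiver.{w, u, v} R} {Q' : GQuiver.{w, u', v'} R}
    {S : Q.Ob × Q'.Ob → Prop} {M : Type*} [AddCommGroup M] [Module R M] {p q : (subProd Q Q' S).Ob}
    {φ : Chain Q' p.1.2 q.1.2 → M} (h : IsMultilinear φ) (c : Chain (subProd Q Q' S) p q) :
    pull (sndMor Q Q' S).obj (sndMor Q Q' S).map φ c = φ (sndChain c) :=
  pull_linMap (Q := subProd Q Q' S) _ _ c h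

theorem comp_prA''_apply {p q : (KA'' F G).Ob} (c : Chain (KA'' F G) p q) :
    pull (prA'' F G).obj (prA'' F G).map (fun t => G.map t) c =
      pull (idKProd F G).obj (idKProd F G).map (fun t => (prA' F).map t) c :=
  (pull_sndMor (G.multilinear _ _) c).trans
    ((idKProd F G).pull_apply_linMap (Q' := A') (fun p : (KA' F).Ob => p.1.2)
      (fun _ _ => LinearMap.snd R _ _) c).symm

theorem comp_prA''_eq : G.comp (prA'' F G) = (prA' F).comp (idKProd F G) := by
  refine FormalMorphism.ext rfl (heq_of_eq ?_)
  funext p q c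
  exact comp_prA''_apply c

/-- The operations on `(K × A'')_{S'}`. -/
noncomputable def pullbackOp (mS : AInfStructure (KA' F)) (D'' : AInfStructure A'')
    {p q : (KA'' F G).Ob} (c : Chain (KA'' F G) p q) : (KA'' F G).Hom p q :=
  ((pull (idKProd F G).obj (idKProd F G).map (fun t => mS.m t) c).1, D''.m (sndChain c))

theorem bdry_pullbackOp_sndChain (mS : AInfStructure (KA' F)) (D'' : AInfStructure A'')
    {M : Type*} [AddCommMonoid M] {p q : (KA'' F G).Ob} (φ : Chain A'' p.1.2 q.1.2 → M)
    (c : Chain (KA'' F G) p q) :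
    bdry (pullbackOp mS D'') (fun t => φ (sndChain t)) c = bdry D''.m φ (sndChain c) :=
  (bdry_map (Q := KA'' F G) (fun p : (KA'' F G).Ob => p.1.2)
    (fun p q (f : (KA'' F G).Hom p q) => f.2) (pullbackOp mS D'') D''.m
    (sgn_graded (Q := KA'' F G) (o := fun p => p.1.2)
      (g := fun _ _ => LinearMap.snd R _ _) fun _ _ _ _ hf => hf.2) (fun _ => rfl) c φ).symm

/-- This is the functor equation for $\mathrm{Id}_K\times G$, stated for the bare operations because
it is used to prove their A∞-relation. -/
theorem bdry_pullbackOp_idKProd {mS : AInfStructure (KA' F)} {D' : AInfStructure A'}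
    {D'' : AInfStructure A''} (hmS : IsAInfFunctor mS D' (prA' F)) (hG : IsAInfFunctor D'' D' G)
    {p q : (KA'' F G).Ob} (c : Chain (KA'' F G) p q) :
    bdry (pullbackOp mS D'') (fun t => (idKProd F G).map t) c =
      pull (idKProd F G).obj (idKProd F G).map (fun t => mS.m t) c := by
  refine Prod.ext ?_ ?_
  · have h1 := map_bdry (pullbackOp mS D'') (AddMonoidHom.fst _ _)
      (fun t => (idKProd F G).map t) c
    refine h1.trans ?_
    exact bdry_apply_linMap (Q := KA'' F G) (Q' := kerQuiver F) (fun p => p.1.1)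
      (fun _ _ => LinearMap.fst R _ _) (pullbackOp mS D'') c
  · have h1 := map_bdry (pullbackOp mS D'') (AddMonoidHom.snd _ _)
      (fun t => (idKProd F G).map t) c
    refine h1.trans ?_
    refine (bdry_pullbackOp_sndChain mS D'' (fun t => G.map t) c).trans ?_
    refine (hG (sndChain c)).trans ?_
    refine (pull_sndMor (G.pull_multilinear (D'.multilinear _ _)) c).symm.trans ?_
    -- Pulling back the operation of `A'` along the two sides of the commutative square gives the
    -- same result; `hmS` then replaces it by the second component of the operation of `mS`.
    have h2 := FormalMorphism.pull_comp G (prA'' F G)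
      (D'.multilinear (G.obj p.1.2) (G.obj q.1.2)) c
    have h3 := FormalMorphism.pull_comp (prA' F) (idKProd F G)
      (D'.multilinear (G.obj p.1.2) (G.obj q.1.2)) c
    have h4 : (fun {p q : (KA'' F G).Ob} (c : Chain (KA'' F G) p q) =>
        pull (prA'' F G).obj (prA'' F G).map (fun t => G.map t) c) = fun {p q} c =>
        pull (idKProd F G).obj (idKProd F G).map (fun t => (prA' F).map t) c := by
      funext p q c
      exact comp_prA''_apply c
    have h5 := congrArg (fun H : ∀ p q : (KA'' F G).Ob, Chain (KA'' F G) p q →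
      A'.Hom (G.obj p.1.2) (G.obj q.1.2) =>
      pull (fun p : (KA'' F G).Ob => G.obj p.1.2) (fun {p q} c => H p q c) (fun t => D'.m t) c) h4
    refine (h2.symm.trans (h5.trans h3)).trans ?_
    refine Eq.trans ?_ (map_pull (idKProd F G).obj (idKProd F G).map (AddMonoidHom.snd _ _)
      (fun t => mS.m t) c).symm
    congr 1
    funext t
    exact (hmS t).symm.trans (bdry_apply_linMap (Q := KA' F) (Q' := A')
      (fun p : (KA' F).Ob => p.1.2) (fun _ _ => LinearMap.snd R _ _) mS.m t)

/-- The A∞-structure on `(K × A'')_{S'}`. -/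
noncomputable def pullbackStructure {mS : AInfStructure (KA' F)} {D' : AInfStructure A'}
    {D'' : AInfStructure A''} (hmS : IsAInfFunctor mS D' (prA' F)) (hG : IsAInfFunctor D'' D' G) :
    AInfStructure (KA'' F G) where
  m c := pullbackOp mS D'' c
  multilinear p q := by
    intro a b t t' r f g
    refine Prod.ext ?_ ?_
    · exact ((idKProd F G).pull_multilinear (mS.multilinear _ _)).comp_linear
        (LinearMap.fst R _ _) a b t t' r f g
    · exact (D''.multilinear _ _).comp_map (Q := KA'' F G) (fun p => p.1.2)
        (fun _ _ => LinearMap.snd R _ _) a b t t' r f g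
  m_mem {p q} c e hc := by
    refine ⟨((idKProd F G).pull_mem 2 mS.m_mem hc).1, ?_⟩
    have := D''.m_mem (sndChain c) e (Chain.IsHomogeneous.map (Q' := A'')
      (fun p : (KA'' F G).Ob => p.1.2) (fun p q (f : (KA'' F G).Hom p q) => f.2)
      (fun _ _ _ _ hf => hf.2) hc)
    rw [sndChain, Chain.length_map] at this
    exact this
  stasheff {p q} c := by
    refine Prod.ext ?_ ?_
    · refine (map_bdry (pullbackOp mS D'') (AddMonoidHom.fst _ _)
        (fun t => pullbackOp mS D'' t) c).trans ?_
      -- The outer operation may be replaced by the full pullback of that of `mS`, since by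
      -- definition the two have the same first component. `bdry_pull` then applies.
      refine (map_bdry (pullbackOp mS D'') (AddMonoidHom.fst _ _)
        (fun t => pull (idKProd F G).obj (idKProd F G).map (fun t => mS.m t) t) c).symm.trans ?_
      have h := (idKProd F G).bdry_pull (pullbackOp mS D'') mS.m
        (bdry_pullbackOp_idKProd hmS hG) (mS.multilinear _ _) c
      refine (congrArg _ h).trans ?_
      have h0 : (fun t => bdry mS.m (fun t => mS.m t) t) =
          fun _ : Chain (KA' F) ((idKProd F G).obj p) ((idKProd F G).obj q) => 0 :=
        funext fun t => mS.stasheff t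
      rw [h0, pull_zero]
      rfl
    · refine (map_bdry (pullbackOp mS D'') (AddMonoidHom.snd _ _)
        (fun t => pullbackOp mS D'' t) c).trans ?_
      exact (bdry_pullbackOp_sndChain mS D'' (fun t => D''.m t) c).trans (D''.stasheff _)

end pullback

end transport

end AInfinity

open AInfinity
theorem theorem2 {R : Type*} [CommRing R] (A : GQuiver R) (A' : GQuiver R) (A'' : GQuiver R)
    (D : AInfStructure A) (D' : AInfStructure A') (D'' : AInfStructure A'')
    (F : FormalMorphism A A') (hF : IsAInfFunctor D D' F) (σ : Splitting F)
    (G : FormalMorphism A'' A') (hG : IsAInfFunctor D'' D' G) :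
    ∃ mS : AInfStructure (KA' F), σ.IsTransported D mS ∧ IsAInfFunctor mS D' (prA' F) ∧
      ∃ Dt : AInfStructure (KA'' F G),
        IsAInfFunctor Dt D'' (prA'' F G) ∧
        IsAInfFunctor Dt mS (idKProd F G) ∧
        G.comp (prA'' F G) = (prA' F).comp (idKProd F G) := by
  obtain ⟨E, hE⟩ := σ.isUnipotent_Phi.exists_transport D
  have hpr : IsAInfFunctor (σ.transport E) D' (prA' F) := σ.isAInfFunctor_prA' hE hF
  exact ⟨σ.transport E, σ.isTransported_transport hE, hpr, pullbackStructure hpr hG,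
    isAInfFunctor_sndMor.2 fun _ => rfl, bdry_pullbackOp_idKProd hpr hG, comp_prA''_eq⟩
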